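/- Let $\mathbb K$ be a field, $d\ge 0$ an integer, and $\mathcal A$ a $\mathbb K$-algebra isomorphic to $\mathrm{Mat}_{d+1}(\mathbb K)$ (rows and columns indexed by $0,\dots,d$). An element of $\mathcal A$ is multiplicity-free if it has $d+1$ distinct eigenvalues in $\mathbb K$; the primitive idempotent of such an element $a$ with eigenvalues $\theta_0,\dots,\theta_d$ associated with $\theta_i$ is $\prod_{j\ne i}(a-\theta_j)/(\theta_i-\theta_j)$. An idempotent sequence for a pair $a,b$ of multiplicity-free elements is an ordering $E_0,\dots,E_d$ of the primitive idempotents of $a$ such that $E_ibE_j=0$ if $|i-j|>1$ and $E_ibE_j\neq0$ if $|i-j|=1$. A Leonard pair in $\mathcal A$ is an ordered pair $A,A^*$ of multiplicity-free elements of $\mathcal A$ such that $A,A^*$ has an idempotent sequence and $A^*,A$ has an idempotent sequence. A choice of idempotent sequences $E_0,\dots,E_d$ for $A,A^*$ and $E^*_0,\dots,E^*_d$ for $A^*,A$ makes it a Leonard system $\Phi=(A,A^*;E_i,E^*_i,i=0..d)$ associated with $A,A^*$; its eigenvalue sequence $\theta_i$ (dual eigenvalue sequence $\theta^*_i$) consists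 of the eigenvalues of $A$ (of $A^*$) associated with $E_i$ (with $E^*_i$). Eigenvalue sequences of a Leonard pair are those of its associated Leonard systems. Let $V$ be an irreducible $\mathcal A$-module and $U_i=(E^*_0V+\cdots+E^*_iV)\cap(E_iV+\cdots+E_dV)$. The first split sequence $\varphi_1,\dots,\varphi_d$ of $\Phi$ is given by: $\varphi_i$ is the eigenvalue of $(A-\theta_{i-1})(A^*-\theta^*_i)$ on $U_i$; the second split sequence $\phi_1,\dots,\phi_d$ is the first split sequence of $(A,A^*;E_{d-i},E^*_i,i=0..d)$. The parameter array of $\Phi$ is $p=(\theta_i,\theta^*_i,i=0..d;\varphi_j,\phi_j,j=1..d)$. The parameter arrays of a Leonard pair are those of its associated Leonard systems. In general, a sequence $p=(\theta_i,\theta^*_i,i=0..d;\varphi_j,\phi_j,j=1..d)$ of scalars in $\mathbb K$ is called a parameter array if (i) all $\varphi_i,\phi_i$ are nonzero; (ii) the $\theta_i$ are mutually distinct and the $\theta^*_i$ are mutually distinct; (iii) $\varphi_i=\phi_1\sum_{h=0}^{i-1}\frac{\theta_h-\theta_{d-h}}{\theta_0-\theta_d}+(\theta^*_i-\theta^*_0)(\theta_{i-1}-\theta_d)$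 for $1\le i\le d$; (iv) $\phi_i=\varphi_1\sum_{h=0}^{i-1}\frac{\theta_h-\theta_{d-h}}{\theta_0-\theta_d}+(\theta^*_i-\theta^*_0)(\theta_{d-i+1}-\theta_0)$ for $1\le i\le d$; (v) the expressions $\frac{\theta_{i-2}-\theta_{i+1}}{\theta_{i-1}-\theta_i}$ and $\frac{\theta^*_{i-2}-\theta^*_{i+1}}{\theta^*_{i-1}-\theta^*_i}$ are equal and independent of $i$ for $2\le i\le d-1$. Put $p^\downarrow=(\theta_i,\theta^*_{d-i},i=0..d;\phi_{d-j+1},\varphi_{d-j+1},j=1..d)$ and $p^\Downarrow=(\theta_{d-i},\theta^*_i,i=0..d;\phi_j,\varphi_j,j=1..d)$. Let $p^D=\mathrm{diag}(\theta^*_0,\dots,\theta^*_d)$ and let $p^T\in\mathrm{Mat}_{d+1}(\mathbb K)$ be the tridiagonal matrix with $$p^T_{ii}=\theta_i+\frac{\varphi_i}{\theta^*_i-\theta^*_{i-1}}+\frac{\varphi_{i+1}}{\theta^*_i-\theta^*_{i+1}}\quad(0\le i\le d)$$ (the terms with $\varphi_0$ and $\varphi_{d+1}$ are read as $0$) and $$p^T_{i-1,i}=\varphi_i\frac{\prod_{h=0}^{i-2}(\theta^*_{i-1}-\theta^*_h)}{\prod_{h=0}^{i-1}(\theta^*_i-\theta^*_h)},\qquad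 p^T_{i,i-1}=\phi_i\frac{\prod_{h=i+1}^{d}(\theta^*_i-\theta^*_h)}{\prod_{h=i}^{d}(\theta^*_{i-1}-\theta^*_h)}\quad(1\le i\le d).$$ A Leonard pair $B,B^*$ in $\mathrm{Mat}_{d+1}(\mathbb K)$ is in TD-D canonical form if $B$ is tridiagonal, $B^*$ is diagonal, and $B$ has constant row sum equal to $\theta_0$ or $\theta_d$, where $\theta_0,\dots,\theta_d$ is an eigenvalue sequence of $B,B^*$. Its designated parameter array is the parameter array of the Leonard system associated with $B,B^*$ whose eigenvalue sequence $\theta_0,\dots,\theta_d$ is such that $B$ has constant row sum $\theta_0$ and whose dual eigenvalue sequence is $B^*_{00},\dots,B^*_{dd}$. A TD-D canonical form for $A,A^*$ is a Leonard pair $B,B^*$ in TD-D canonical form such that some isomorphism of $\mathbb K$-algebras $\mathcal A\to\mathrm{Mat}_{d+1}(\mathbb K)$ sends $A$ to $B$ and $A^*$ to $B^*$. Theorem. Let $A,A^*$ be a Leonard pair in $\mathcal A$. Every parameter array $p$ of $A,A^*$ satisfies (i)–(v), and the set of parameter arrays of $A,A^*$ is $\{p,p^\downarrow,p^\Downarrow,p^{\downarrow\Downarrow}\}$.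 The map $p\mapsto(p^T,p^D)$ is a bijection from the set of parameter arrays of $A,A^*$ onto the set of TD-D canonical forms for $A,A^*$; its inverse sends each TD-D canonical form for $A,A^*$ to its designated parameter array. Consequently there are exactly four TD-D canonical forms for $A,A^*$ if $d\ge1$, and exactly one if $d=0$. -/

import Mathlib

universe u v w

namespace LeonardPairs

section Algebra

variable (K : Type u) [Field K] {𝓐 : Type v} [Ring 𝓐] [Algebra K 𝓐] (d : ℕ)

/-- `𝓐` is a matrix algebra over `K` of diameter `d`: a `K`-algebra isomorphic to
`Mat_{d+1}(K)`. -/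
def IsMatrixAlgebra (𝓐 : Type v) [Ring 𝓐] [Algebra K 𝓐] : Prop :=
  Nonempty (𝓐 ≃ₐ[K] Matrix (Fin (d + 1)) (Fin (d + 1)) K)

/-- An element of a matrix algebra of diameter `d` is multiplicity-free when it has `d + 1`
distinct eigenvalues in `K` (the eigenvalues of `a` in `K` are the elements of its spectrum). -/
def IsMultiplicityFree (a : 𝓐) : Prop :=
  (spectrum K a).ncard = d + 1

variable {K d}

/-- `θ 0, …, θ d` is an ordering of the (mutually distinct) eigenvalues of `a`. -/
def IsEigenvalueOrdering (a : 𝓐) (θ : Fin (d + 1) → K) : Prop :=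
  Function.Injective θ ∧ Set.range θ = spectrum K a

/-- `∏_{j ≠ i} (a - θ j) / (θ i - θ j)`, the primitive idempotent of `a` associated with `θ i`,
written as the value at `a` of the Lagrange polynomial
`∏_{j ≠ i} (X - θ j) / (θ i - θ j)`. -/
noncomputable def primitiveIdempotent (a : 𝓐) (θ : Fin (d + 1) → K) (i : Fin (d + 1)) : 𝓐 :=
  Polynomial.aeval a (Lagrange.basis Finset.univ θ i)

/-- `E 0, …, E d` are the primitive idempotents of `a`, and `θ i` is the eigenvalue of `a`
associated with `E i`. -/
def IsEigenvalueSequence (a : 𝓐) (E : Fin (d + 1) → 𝓐) (θ : Fin (d + 1) → K) : Prop :=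
  IsEigenvalueOrdering a θ ∧ ∀ i, E i = primitiveIdempotent a θ i

variable (K)

/-- `E 0, …, E d` is an idempotent sequence for the pair `a, b`: an ordering of the primitive
idempotents of `a` such that `E i * b * E j` is zero if `|i - j| > 1` and nonzero if
`|i - j| = 1`. -/
def IsIdempotentSequence (a b : 𝓐) (E : Fin (d + 1) → 𝓐) : Prop :=
  (∃ θ : Fin (d + 1) → K, IsEigenvalueSequence a E θ) ∧
  ∀ i j : Fin (d + 1),
    (1 < |(i : ℤ) - (j : ℤ)| → E i * b * E j = 0) ∧
    (|(i : ℤ) - (j : ℤ)| = 1 → E i * b * E j ≠ 0)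

variable (d)

/-- The ordered pair `A, As` is a Leonard pair in the matrix algebra `𝓐` of diameter `d`. -/
structure IsLeonardPair (A As : 𝓐) : Prop where
  multiplicityFree : IsMultiplicityFree K d A
  multiplicityFree_star : IsMultiplicityFree K d As
  exists_idempotentSequence : ∃ E : Fin (d + 1) → 𝓐, IsIdempotentSequence K A As E
  exists_dualIdempotentSequence : ∃ Es : Fin (d + 1) → 𝓐, IsIdempotentSequence K As A Es

/-- A Leonard system `(A, As; E i, Es i, i = 0..d)` in the matrix algebra `𝓐` of diameter `d`. -/
structure LeonardSystem (𝓐 : Type v) [Ring 𝓐] [Algebra K 𝓐] where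
  A : 𝓐
  As : 𝓐
  E : Fin (d + 1) → 𝓐
  Es : Fin (d + 1) → 𝓐
  multiplicityFree : IsMultiplicityFree K d A
  multiplicityFree_star : IsMultiplicityFree K d As
  idempotentSequence : IsIdempotentSequence K A As E
  dualIdempotentSequence : IsIdempotentSequence K As A Es

/-- Two pairs `A, As` in `𝓐` and `B, Bs` in `𝓑` are isomorphic: some isomorphism of `K`-algebras
sends `A` to `B` and `As` to `Bs`. -/
def PairIsomorphic {𝓑 : Type w} [Ring 𝓑] [Algebra K 𝓑] (A As : 𝓐) (B Bs : 𝓑) : Prop :=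
  ∃ σ : 𝓐 ≃ₐ[K] 𝓑, σ A = B ∧ σ As = Bs

variable {K d}

theorem primitiveIdempotent_rev (a : 𝓐) (θ : Fin (d + 1) → K) (i : Fin (d + 1)) :
    primitiveIdempotent a (fun j => θ j.rev) i = primitiveIdempotent a θ i.rev := by
  unfold primitiveIdempotent Lagrange.basis
  congr 1
  refine Finset.prod_equiv Fin.revPerm ?_ ?_
  · intro j
    simp [Fin.rev_inj]
  · intro j _
    simp

theorem IsEigenvalueSequence.rev {a : 𝓐} {E : Fin (d + 1) → 𝓐} {θ : Fin (d + 1) → K}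
    (h : IsEigenvalueSequence a E θ) :
    IsEigenvalueSequence a (fun i => E i.rev) (fun i => θ i.rev) := by
  refine ⟨⟨h.1.1.comp Fin.rev_injective, ?_⟩, fun i => ?_⟩
  · rw [← h.1.2]
    exact Fin.rev_surjective.range_comp θ
  · rw [primitiveIdempotent_rev]
    exact h.2 _

theorem IsIdempotentSequence.rev {a b : 𝓐} {E : Fin (d + 1) → 𝓐}
    (h : IsIdempotentSequence K a b E) : IsIdempotentSequence K a b (fun i => E i.rev) := by
  obtain ⟨⟨θ, hθ⟩, h2⟩ := h
  refine ⟨⟨_, hθ.rev⟩, fun i j => ?_⟩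
  have key : |((i.rev : Fin (d + 1)) : ℤ) - ((j.rev : Fin (d + 1)) : ℤ)| = |(i : ℤ) - (j : ℤ)| := by
    have hi := i.isLt
    have hj := j.isLt
    have e : ((i.rev : Fin (d + 1)) : ℤ) - ((j.rev : Fin (d + 1)) : ℤ) = (j : ℤ) - (i : ℤ) := by
      simp only [Fin.val_rev]
      omega
    rw [e, abs_sub_comm]
  have := h2 i.rev j.rev
  rwa [key] at this

/-- The second inversion `(A, As; E (d - i), Es i, i = 0..d)` of a Leonard system. -/
def LeonardSystem.secondInversion (Φ : LeonardSystem K d 𝓐) : LeonardSystem K d 𝓐 where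
  A := Φ.A
  As := Φ.As
  E := fun i => Φ.E i.rev
  Es := Φ.Es
  multiplicityFree := Φ.multiplicityFree
  multiplicityFree_star := Φ.multiplicityFree_star
  idempotentSequence := Φ.idempotentSequence.rev
  dualIdempotentSequence := Φ.dualIdempotentSequence

/-- The subspace `e V` of a left `𝓐`-module `V`. -/
def imageOf (K : Type u) [Field K] {𝓐 : Type v} [Ring 𝓐] [Algebra K 𝓐] (e : 𝓐)
    (V : Type w) [AddCommGroup V] [Module K V] [Module 𝓐 V] [IsScalarTower K 𝓐 V] :
    Submodule K V :=
  LinearMap.range (Algebra.lsmul K K V e)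

/-- `U_i = (Es 0 V + ⋯ + Es i V) ∩ (E i V + ⋯ + E d V)`. -/
def LeonardSystem.splitSpace (Φ : LeonardSystem K d 𝓐)
    (V : Type w) [AddCommGroup V] [Module K V] [Module 𝓐 V] [IsScalarTower K 𝓐 V]
    (i : Fin (d + 1)) : Submodule K V :=
  (⨆ h ∈ Finset.Iic i, imageOf K (Φ.Es h) V) ⊓ (⨆ h ∈ Finset.Ici i, imageOf K (Φ.E h) V)

/-- `φ` is the first split sequence of `Φ`; the entry `φ_{j+1}` (`0 ≤ j ≤ d - 1`) of the sequence
`φ_1, …, φ_d` is written `φ j`. On every irreducible `𝓐`-module `V`, the scalar `φ_i`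
is the eigenvalue of `(A - θ_{i-1}) (As - θs_i)` on `U_i`, where `θ` and `θs` are the eigenvalue
sequence and the dual eigenvalue sequence of `Φ`. -/
def LeonardSystem.IsFirstSplitSequence (Φ : LeonardSystem K d 𝓐) (φ : Fin d → K) : Prop :=
  ∀ θ θs : Fin (d + 1) → K,
    IsEigenvalueSequence Φ.A Φ.E θ → IsEigenvalueSequence Φ.As Φ.Es θs →
    ∀ (V : Type v) [AddCommGroup V] [Module K V] [Module 𝓐 V] [IsScalarTower K 𝓐 V]
      [IsSimpleModule 𝓐 V] (j : Fin d), ∀ x ∈ Φ.splitSpace V j.succ,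
      ((Φ.A - algebraMap K 𝓐 (θ j.castSucc)) * (Φ.As - algebraMap K 𝓐 (θs j.succ))) • x = φ j • x

/-- `θ` is an eigenvalue sequence for the pair `A, As`: the eigenvalue sequence of a Leonard
system associated with this pair. -/
def IsEigenvalueSequenceOfPair (A As : 𝓐) (θ : Fin (d + 1) → K) : Prop :=
  ∃ Φ : LeonardSystem K d 𝓐, Φ.A = A ∧ Φ.As = As ∧ IsEigenvalueSequence Φ.A Φ.E θ

end Algebra

/-- A sequence of scalars `(θ_i, θs_i, i = 0..d; φ_j, ϕ_j, j = 1..d)`. The entries `φ_{j+1}` and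
`ϕ_{j+1}` (`0 ≤ j ≤ d - 1`) are written `firstSplit j` and `secondSplit j`. -/
@[ext]
structure ScalarArray (K : Type u) (d : ℕ) where
  theta : Fin (d + 1) → K
  thetaStar : Fin (d + 1) → K
  firstSplit : Fin d → K
  secondSplit : Fin d → K

namespace ScalarArray

variable {K : Type u} [Field K] {d : ℕ}

/-- `∑_{h=0}^{j} (θ_h - θ_{d-h}) / (θ_0 - θ_d)`. -/
def thetaSum (p : ScalarArray K d) (j : Fin d) : K :=
  ∑ h ∈ Finset.Iic j.castSucc, (p.theta h - p.theta h.rev) / (p.theta 0 - p.theta (Fin.last d))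

/-- The five conditions that define a parameter array over `K` of diameter `d`; in `eq_first` and
`eq_second` the index `i = j + 1` runs over `1..d`, and in `recurrence` the index `i = k + 2` runs
over `2..d-1`. -/
structure IsParameterArray (p : ScalarArray K d) : Prop where
  first_ne_zero : ∀ j, p.firstSplit j ≠ 0
  second_ne_zero : ∀ j, p.secondSplit j ≠ 0
  theta_ne : ∀ i j, i ≠ j → p.theta i ≠ p.theta j
  thetaStar_ne : ∀ i j, i ≠ j → p.thetaStar i ≠ p.thetaStar j
  eq_first : ∀ j : Fin d,
    p.firstSplit j = p.secondSplit ⟨0, j.pos⟩ * p.thetaSum j +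
      (p.thetaStar j.succ - p.thetaStar 0) * (p.theta j.castSucc - p.theta (Fin.last d))
  eq_second : ∀ j : Fin d,
    p.secondSplit j = p.firstSplit ⟨0, j.pos⟩ * p.thetaSum j +
      (p.thetaStar j.succ - p.thetaStar 0) * (p.theta j.castSucc.rev - p.theta 0)
  recurrence : ∃ c : K, ∀ (k : ℕ) (hk : k + 3 ≤ d),
    (p.theta ⟨k, by omega⟩ - p.theta ⟨k + 3, by omega⟩) /
      (p.theta ⟨k + 1, by omega⟩ - p.theta ⟨k + 2, by omega⟩) = c ∧
    (p.thetaStar ⟨k, by omega⟩ - p.thetaStar ⟨k + 3, by omega⟩) /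
      (p.thetaStar ⟨k + 1, by omega⟩ - p.thetaStar ⟨k + 2, by omega⟩) = c

/-- `(θ_i, θs_{d-i}, i = 0..d; ϕ_{d-j+1}, φ_{d-j+1}, j = 1..d)`. -/
def down (p : ScalarArray K d) : ScalarArray K d where
  theta := p.theta
  thetaStar := fun i => p.thetaStar i.rev
  firstSplit := fun j => p.secondSplit j.rev
  secondSplit := fun j => p.firstSplit j.rev

/-- `(θ_{d-i}, θs_i, i = 0..d; ϕ_j, φ_j, j = 1..d)`. -/
def ddown (p : ScalarArray K d) : ScalarArray K d where
  theta := fun i => p.theta i.rev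
  thetaStar := p.thetaStar
  firstSplit := p.secondSplit
  secondSplit := p.firstSplit

/-- The tridiagonal matrix `p^T`; terms of the diagonal entries that involve `φ_0 = 0` or
`φ_{d+1} = 0` are omitted. -/
def tMatrix (p : ScalarArray K d) : Matrix (Fin (d + 1)) (Fin (d + 1)) K :=
  Matrix.of fun i j =>
    if i = j then
      p.theta i
        + (if h : 0 < (i : ℕ) then
            p.firstSplit ⟨(i : ℕ) - 1, by omega⟩ /
              (p.thetaStar i - p.thetaStar ⟨(i : ℕ) - 1, by omega⟩)
          else 0)
        + (if h : (i : ℕ) < d then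
            p.firstSplit ⟨i, h⟩ / (p.thetaStar i - p.thetaStar ⟨(i : ℕ) + 1, by omega⟩)
          else 0)
    else if h : (i : ℕ) + 1 = (j : ℕ) then
      p.firstSplit ⟨i, by omega⟩ *
        ((∏ h ∈ Finset.Iio i, (p.thetaStar i - p.thetaStar h)) /
          ∏ h ∈ Finset.Iio j, (p.thetaStar j - p.thetaStar h))
    else if h : (j : ℕ) + 1 = (i : ℕ) then
      p.secondSplit ⟨j, by omega⟩ *
        ((∏ h ∈ Finset.Ioi i, (p.thetaStar i - p.thetaStar h)) /
          ∏ h ∈ Finset.Ioi j, (p.thetaStar j - p.thetaStar h))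
    else 0

/-- The diagonal matrix `p^D`. -/
def dMatrix (p : ScalarArray K d) : Matrix (Fin (d + 1)) (Fin (d + 1)) K :=
  Matrix.diagonal p.thetaStar

variable {𝓐 : Type v} [Ring 𝓐] [Algebra K 𝓐]

/-- `p` is the parameter array of the Leonard system `Φ`: it consists of the eigenvalue sequence,
the dual eigenvalue sequence, the first split sequence and the second split sequence of `Φ`, the
latter being the first split sequence of the second inversion of `Φ`. -/
structure IsOfSystem (p : ScalarArray K d) (Φ : LeonardSystem K d 𝓐) : Prop where
  theta : IsEigenvalueSequence Φ.A Φ.E p.theta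
  thetaStar : IsEigenvalueSequence Φ.As Φ.Es p.thetaStar
  firstSplit : Φ.IsFirstSplitSequence p.firstSplit
  secondSplit : Φ.secondInversion.IsFirstSplitSequence p.secondSplit

end ScalarArray

section Pairs

variable (K : Type u) [Field K] (d : ℕ) {𝓐 : Type v} [Ring 𝓐] [Algebra K 𝓐]

/-- The parameter arrays of a Leonard pair `A, As`: the parameter arrays of the Leonard systems
associated with this pair. -/
def parameterArrays (A As : 𝓐) : Set (ScalarArray K d) :=
  {p | ∃ Φ : LeonardSystem K d 𝓐, Φ.A = A ∧ Φ.As = As ∧ p.IsOfSystem Φ}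

variable {K d}

/-- A square matrix is tridiagonal when each nonzero entry lies on the diagonal, the subdiagonal or
the superdiagonal. -/
def IsTridiagonal (B : Matrix (Fin (d + 1)) (Fin (d + 1)) K) : Prop :=
  ∀ i j, B i j ≠ 0 → i = j ∨ (i : ℕ) + 1 = (j : ℕ) ∨ (j : ℕ) + 1 = (i : ℕ)

/-- The matrix `B` has constant row sum `α`. -/
def HasConstantRowSum (B : Matrix (Fin (d + 1)) (Fin (d + 1)) K) (α : K) : Prop :=
  ∀ i, ∑ j, B i j = α

/-- `B, Bs` is a Leonard pair in `Mat_{d+1}(K)` which is in TD-D canonical form. -/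
structure IsInTDDForm (B Bs : Matrix (Fin (d + 1)) (Fin (d + 1)) K) : Prop where
  leonardPair : IsLeonardPair K d B Bs
  tridiagonal : IsTridiagonal B
  diagonal : Bs.IsDiag
  rowSum : ∃ θ : Fin (d + 1) → K, IsEigenvalueSequenceOfPair B Bs θ ∧
    (HasConstantRowSum B (θ 0) ∨ HasConstantRowSum B (θ (Fin.last d)))

variable (K d)

/-- The TD-D canonical forms for `A, As`: the Leonard pairs in TD-D canonical form which are
isomorphic to `A, As`. -/
def tddCanonicalForms (A As : 𝓐) :
    Set (Matrix (Fin (d + 1)) (Fin (d + 1)) K × Matrix (Fin (d + 1)) (Fin (d + 1)) K) :=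
  {C | IsInTDDForm C.1 C.2 ∧ PairIsomorphic K A As C.1 C.2}

variable {K d}

/-- `p` is the designated parameter array of a Leonard pair `B, Bs` in TD-D canonical form: the
parameter array of the Leonard system associated with `B, Bs` whose eigenvalue sequence
`θ_0, …, θ_d` is such that `B` has constant row sum `θ_0`, and whose dual eigenvalue sequence is the
sequence of diagonal entries of `Bs`. -/
def IsDesignatedParameterArray (B Bs : Matrix (Fin (d + 1)) (Fin (d + 1)) K)
    (p : ScalarArray K d) : Prop :=
  ∃ Φ : LeonardSystem K d (Matrix (Fin (d + 1)) (Fin (d + 1)) K),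
    Φ.A = B ∧ Φ.As = Bs ∧ p.IsOfSystem Φ ∧
    HasConstantRowSum B (p.theta 0) ∧ ∀ i, p.thetaStar i = Bs i i

end Pairs

end LeonardPairs

/-!
Let `Φ` be a Leonard system acting on an irreducible module `V`. Coordinates of `V` with respect to
eigenvectors of `As` and with respect to eigenvectors of `A` form two frames (`TriFrame`): in each of
them one of `A, As` is diagonal and the other one is irreducible tridiagonal. If `v` spans `Es 0 V`,
the vectors `u i = (A - θ 0) ⋯ (A - θ (i - 1)) v` span the split spaces `U i`
(`TriFrame.eq_smul_splitVec`), `A` is lower bidiagonal and `As` is upper bidiagonal on them, and the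
first split sequence `φ` is the superdiagonal of `As`.

*Corners.* Comparing the split basis with the eigenbasis of `As` gives
`Es i A Es i = (θ i + φ i / (θs i - θs (i - 1)) + φ (i + 1) / (θs i - θs (i + 1))) Es i`, and these
equations determine `φ` (`LeonardSystem.isFirstSplitSequence_iff`). The description makes no reference
to modules; it yields existence and uniqueness of the split sequences, their invariance under
isomorphisms and their behaviour under inversion. The same equations hold for the split sequence of
the dual system, so the two agree (`TriFrame.splitCoeff_dual`).

*The five conditions.* A polynomial `p` with
`p (θ i) - p (θ (i + 1)) = θ i ^ 2 * θ (i + 1) - θ i * θ (i + 1) ^ 2` satisfies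
`A ^ 2 As A - A As A ^ 2 = p(A) As - As p(A)`, and this relation, evaluated on `Es 0 V`, bounds its
degree by three (`TriFrame.exists_relation`). Its coefficients in the split basis are linear
recurrences for the eigenvalues and the dual eigenvalues, which give condition (v), and one for
`φ` (`TriFrame.exists_recurrence`). The right-hand side of condition (iii) solves the recurrence for
`φ`, with the same values at `0, 1, d, d + 1`; the difference `δ` vanishes, because otherwise `θ i`
would be a combination of `1`, `δ i`, `δ (i + 1)` and `θ 0 = θ d` would follow
(`eq_zero_of_recurrence`, `eq_of_recurrence`). Condition (iv) is condition (iii) for the second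
inversion.

*Canonical forms.* An idempotent sequence is unique up to reversal, which gives the four parameter
arrays (`parameterArrays_eq`). For a nonzero vector in `E 0 V`, its components in the spaces `Es i V`
form a basis with respect to which `A, As` become `p^T, p^D`
(`ScalarArray.IsOfSystem.toMatrix_eq_tMatrix`): the entries above the diagonal come from the dual split
basis, those below from the inverted system. Conversely, in a TD-D canonical form with row sum `θ 0`
the standard basis is such a basis for the designated system.
-/

namespace LeonardPairs

/-! ### Coordinates adapted to a Leonard pair, and the split basis -/

/-- Coordinates `X 0, …, X d` on a vector space `V` with respect to which `As` is diagonal, with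
eigenvalues `e 0, …, e d`, and `A` is irreducible tridiagonal, with diagonal entries `a i`, entries
`b i` at the places `(i, i + 1)` and entries `c i` at the places `(i + 1, i)`. The vector `v` is the
first vector of the dual basis.

The coordinates are indexed by `ℕ` and vanish beyond `d`, so that no entry of `A` has to be singled
out at the upper end. The values of `e`, `a` beyond `d`, and those of `b`, `c` from `d` on, carry no
information. A Leonard system gives a frame for `A, As` and a frame for `As, A`. -/
structure TriFrame {K : Type u} [Field K] {V : Type v} [AddCommGroup V] [Module K V] (d : ℕ)
    (A As : Module.End K V) where
  X : ℕ → V →ₗ[K] K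
  e : ℕ → K
  a : ℕ → K
  b : ℕ → K
  c : ℕ → K
  v : V
  X_of_lt : ∀ j, d < j → X j = 0
  ext_zero : ∀ x, (∀ j ≤ d, X j x = 0) → x = 0
  e_inj : ∀ i ≤ d, ∀ j ≤ d, e i = e j → i = j
  X_diag : ∀ j x, X j (As x) = e j * X j x
  X_tri_zero : ∀ x, X 0 (A x) = a 0 * X 0 x + b 0 * X 1 x
  X_tri_succ : ∀ j < d, ∀ x,
    X (j + 1) (A x) = c j * X j x + a (j + 1) * X (j + 1) x + b (j + 1) * X (j + 2) x
  b_ne : ∀ j < d, b j ≠ 0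
  c_ne : ∀ j < d, c j ≠ 0
  X_v_zero : X 0 v = 1
  X_v_succ : ∀ j, X (j + 1) v = 0

namespace TriFrame

variable {K : Type u} [Field K] {V : Type v} [AddCommGroup V] [Module K V] {d : ℕ}
  {A As : Module.End K V}

theorem sub_ne (F : TriFrame d A As) {i j : ℕ} (hi : i ≤ d) (hj : j ≤ d) (h : i ≠ j) :
    F.e i - F.e j ≠ 0 :=
  sub_ne_zero.2 fun h' => h (F.e_inj i hi j hj h')

theorem X_tri_of_lt (F : TriFrame d A As) {x : V} {m j : ℕ} (hx : ∀ j, m < j → F.X j x = 0)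
    (hj : m + 1 < j) : F.X j (A x) = 0 := by
  obtain ⟨j, rfl⟩ : ∃ k, j = k + 1 := ⟨j - 1, by omega⟩
  by_cases h : j < d
  · rw [F.X_tri_succ j h, hx j (by omega), hx (j + 1) (by omega), hx (j + 2) (by omega)]
    simp
  · rw [F.X_of_lt _ (by omega)]; rfl

theorem X_tri_top (F : TriFrame d A As) {x : V} {m : ℕ} (hx : ∀ j, m < j → F.X j x = 0)
    (hm : m < d) : F.X (m + 1) (A x) = F.c m * F.X m x := by
  rw [F.X_tri_succ m hm, hx (m + 1) (by omega), hx (m + 2) (by omega)]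
  simp

theorem X_tri_low (G : TriFrame d A As) {x : V} {m j : ℕ} (hx : ∀ j < m + 1, G.X j x = 0)
    (hj : j < m) : G.X j (A x) = 0 := by
  rcases j with _ | j
  · rw [G.X_tri_zero, hx 0 (by omega), hx 1 (by omega)]; simp
  · by_cases h : j < d
    · rw [G.X_tri_succ j h, hx j (by omega), hx (j + 1) (by omega), hx (j + 2) (by omega)]
      simp
    · rw [G.X_of_lt _ (by omega)]; rfl

theorem X_tri_bot (G : TriFrame d A As) {x : V} {m : ℕ} (hx : ∀ j < m + 1, G.X j x = 0)
    (hm : m ≤ d) : G.X m (A x) = G.b m * G.X (m + 1) x := by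
  rcases m with _ | m
  · rw [G.X_tri_zero, hx 0 (by omega)]; simp
  · rw [G.X_tri_succ m (by omega), hx m (by omega), hx (m + 1) (by omega)]
    simp

/-- An eigenvector of `A` whose coordinate `X d` vanishes is zero, as its coordinates can be
computed from the last one downwards. -/
theorem eq_zero_of_eigen (F : TriFrame d A As) {x : V} {t : K} {i : ℕ} (hi : i ≤ d)
    (hX : ∀ j, i ≤ j → F.X j x = 0) (hA : A x - t • x = 0) : x = 0 := by
  have key : ∀ n j, i ≤ j + n → F.X j x = 0 := by
    intro n
    induction n with
    | zero => exact fun j hj => hX j hj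
    | succ n ih =>
      intro j hj
      by_cases h : i ≤ j
      · exact hX j h
      have h1 := congrArg (F.X (j + 1)) hA
      have hjd : j < d := by omega
      simp only [map_sub, map_smul, map_zero, smul_eq_mul] at h1
      rw [F.X_tri_succ j hjd, ih (j + 1) (by omega), ih (j + 2) (by omega)] at h1
      simpa [F.c_ne j hjd] using h1
  exact F.ext_zero x fun j _ => key i j (by omega)

/-- The spaces `Es 0 V + ⋯ + Es (i - 1) V` and `E i V + ⋯ + E d V` intersect trivially: `A - θ i`
maps the intersection into the one for `i + 1`, so by induction it vanishes there. -/
theorem eq_zero_of_X_of_X (F : TriFrame d A As) (G : TriFrame d As A) :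
    ∀ (n i : ℕ), d + 1 ≤ i + n → ∀ x : V, (∀ j, i ≤ j → F.X j x = 0) →
      (∀ j < i, G.X j x = 0) → x = 0 := by
  intro n
  induction n with
  | zero =>
    intro i hi x _ hY
    exact G.ext_zero x fun j hj => hY j (by omega)
  | succ n ih =>
    intro i hi x hX hY
    by_cases hid : d < i
    · exact G.ext_zero x fun j hj => hY j (by omega)
    refine F.eq_zero_of_eigen (t := G.e i) (by omega) hX (ih (i + 1) (by omega) _ ?_ ?_)
    · intro j hj
      obtain ⟨j, rfl⟩ : ∃ k, j = k + 1 := ⟨j - 1, by omega⟩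
      by_cases h : j < d
      · simp [F.X_tri_succ j h, hX j (by omega), hX (j + 1) (by omega), hX (j + 2) (by omega)]
      · rw [F.X_of_lt _ (by omega)]; rfl
    · intro j hj
      simp only [map_sub, map_smul, G.X_diag, smul_eq_mul]
      rcases Nat.lt_or_ge j i with h | h
      · simp [hY j h]
      · obtain rfl : j = i := by omega
        ring

/-- The split basis `u i = (A - θ 0) ⋯ (A - θ (i - 1)) v`, where `v` spans `Es 0 V`. -/
noncomputable def splitVec (F : TriFrame d A As) (G : TriFrame d As A) : ℕ → V
  | 0 => F.v
  | i + 1 => A (splitVec F G i) - G.e i • splitVec F G i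

section Split

variable (F : TriFrame d A As) (G : TriFrame d As A)

theorem A_splitVec (i : ℕ) :
    A (F.splitVec G i) = G.e i • F.splitVec G i + F.splitVec G (i + 1) := by
  simp [splitVec]

theorem X_splitVec_of_lt (i j : ℕ) (hij : i < j) : F.X j (F.splitVec G i) = 0 := by
  induction i generalizing j with
  | zero =>
    obtain ⟨j, rfl⟩ : ∃ k, j = k + 1 := ⟨j - 1, by omega⟩
    exact F.X_v_succ j
  | succ i ih =>
    simp only [splitVec, map_sub, map_smul]
    rw [F.X_tri_of_lt ih hij, ih j (by omega)]
    simp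

theorem X_splitVec_succ (i : ℕ) (hi : i < d) :
    F.X (i + 1) (F.splitVec G (i + 1)) = F.c i * F.X i (F.splitVec G i) := by
  simp only [splitVec, map_sub, map_smul]
  rw [F.X_tri_top (X_splitVec_of_lt F G i) hi, X_splitVec_of_lt F G i (i + 1) (by omega)]
  simp

theorem X_splitVec_ne (i : ℕ) (hi : i ≤ d) : F.X i (F.splitVec G i) ≠ 0 := by
  induction i with
  | zero => simp [splitVec, F.X_v_zero]
  | succ i ih =>
    rw [X_splitVec_succ F G i (by omega)]
    exact mul_ne_zero (F.c_ne i (by omega)) (ih (by omega))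

theorem Y_splitVec (i j : ℕ) (hj : j < i) : G.X j (F.splitVec G i) = 0 := by
  induction i with
  | zero => omega
  | succ i ih =>
    simp only [splitVec, map_sub, map_smul, G.X_diag, smul_eq_mul]
    rcases Nat.lt_or_ge j i with h | h
    · simp [ih h]
    · obtain rfl : j = i := by omega
      ring

theorem splitVec_of_lt (i : ℕ) (hi : d < i) : F.splitVec G i = 0 :=
  G.ext_zero _ fun j hj => Y_splitVec F G i j (by omega)

theorem splitVec_ne_zero (i : ℕ) (hi : i ≤ d) : F.splitVec G i ≠ 0 := fun h =>
  X_splitVec_ne F G i hi (by rw [h, map_zero])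

theorem Y_splitVec_ne (i : ℕ) (hi : i ≤ d) : G.X i (F.splitVec G i) ≠ 0 := by
  intro h
  refine splitVec_ne_zero F G i hi (F.eq_zero_of_X_of_X G (d + 1) (i + 1) (by omega) _ ?_ ?_)
  · exact fun j hj => X_splitVec_of_lt F G i j hj
  · intro j hj
    rcases Nat.lt_or_ge j i with h' | h'
    · exact Y_splitVec F G i j h'
    · obtain rfl : j = i := by omega
      exact h

/-- The split space `U i` is spanned by `splitVec i`. -/
theorem eq_smul_splitVec (i : ℕ) (hi : i ≤ d) (x : V) (hX : ∀ j, i < j → F.X j x = 0)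
    (hY : ∀ j < i, G.X j x = 0) :
    x = (F.X i x / F.X i (F.splitVec G i)) • F.splitVec G i := by
  rw [← sub_eq_zero]
  refine F.eq_zero_of_X_of_X G (d + 1) i (by omega) _ ?_ ?_
  · intro j hj
    simp only [map_sub, map_smul, smul_eq_mul]
    rcases Nat.lt_or_ge i j with h | h
    · rw [hX j h, X_splitVec_of_lt F G i j h]; simp
    · obtain rfl : j = i := by omega
      rw [div_mul_cancel₀ _ (X_splitVec_ne F G j hi), sub_self]
  · intro j hj
    simp [hY j hj, Y_splitVec F G i j hj]

/-- The first split sequence `φ 1, …, φ d`, extended by `φ 0 = 0` and by `φ i = 0` for `i > d`. It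
is read off from the coordinates of the split basis, and `splitVec` vanishes beyond `d`. -/
noncomputable def splitCoeff : ℕ → K
  | 0 => 0
  | i + 1 => (F.e i - F.e (i + 1)) * F.X i (F.splitVec G (i + 1)) / F.X i (F.splitVec G i)

theorem splitCoeff_of_lt (i : ℕ) (hi : d < i) : F.splitCoeff G i = 0 := by
  obtain ⟨i, rfl⟩ : ∃ k, i = k + 1 := ⟨i - 1, by omega⟩
  simp [splitCoeff, splitVec_of_lt F G _ hi]

theorem As_splitVec_zero : As (F.splitVec G 0) = F.e 0 • F.splitVec G 0 := by
  rw [← sub_eq_zero]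
  refine F.ext_zero _ fun j _ => ?_
  rcases j with _ | j
  · simp [F.X_diag]
  · simp [F.X_diag, X_splitVec_of_lt F G 0 (j + 1) (by omega)]

theorem As_splitVec_succ (i : ℕ) :
    As (F.splitVec G (i + 1)) =
      F.e (i + 1) • F.splitVec G (i + 1) + F.splitCoeff G (i + 1) • F.splitVec G i := by
  by_cases hi : d < i + 1
  · rw [splitCoeff_of_lt F G _ hi, splitVec_of_lt F G _ hi]; simp
  rw [← sub_eq_zero]
  refine F.eq_zero_of_X_of_X G (d + 1) i (by omega) _ ?_ ?_
  · intro j hj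
    simp only [map_sub, map_smul, map_add, smul_eq_mul, F.X_diag]
    rcases Nat.lt_or_ge i j with h | h
    · rw [X_splitVec_of_lt F G i j h]
      rcases Nat.lt_or_ge (i + 1) j with h' | h'
      · rw [X_splitVec_of_lt F G (i + 1) j h']; simp
      · obtain rfl : j = i + 1 := by omega
        ring
    · obtain rfl : j = i := by omega
      have := X_splitVec_ne F G j (by omega)
      simp only [splitCoeff]
      field_simp
      ring
  · intro j hj
    simp only [map_sub, map_smul, map_add, smul_eq_mul]
    rw [G.X_tri_low (Y_splitVec F G (i + 1)) hj, Y_splitVec F G _ j hj,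
      Y_splitVec F G _ j (by omega)]
    simp

theorem As_splitVec (i : ℕ) :
    As (F.splitVec G i) =
      F.e i • F.splitVec G i + F.splitCoeff G i • F.splitVec G (i - 1) := by
  rcases i with _ | i
  · simp [As_splitVec_zero, splitCoeff]
  · exact As_splitVec_succ F G i

theorem splitCoeff_ne_zero (i : ℕ) (hi : i < d) : F.splitCoeff G (i + 1) ≠ 0 := by
  intro h
  have h1 := congrArg (G.X i) (As_splitVec_succ F G i)
  rw [h, zero_smul, add_zero, G.X_tri_bot (Y_splitVec F G (i + 1)) hi.le, map_smul,
    Y_splitVec F G (i + 1) i (by omega), smul_zero] at h1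
  exact mul_ne_zero (G.b_ne i hi) (Y_splitVec_ne F G (i + 1) hi) h1

/-- `(A - θ (i - 1)) (As - θs i)` acts on the split space `U i` as the scalar `φ i`. -/
theorem splitCoeff_apply (i : ℕ) (hi : i < d) (x : V) (hX : ∀ j, i + 1 < j → F.X j x = 0)
    (hY : ∀ j < i + 1, G.X j x = 0) :
    A (As x - F.e (i + 1) • x) - G.e i • (As x - F.e (i + 1) • x) =
      F.splitCoeff G (i + 1) • x := by
  rw [eq_smul_splitVec F G (i + 1) hi x hX hY]
  simp only [map_smul, As_splitVec_succ, map_sub, map_add, A_splitVec]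
  module

/-- The diagonal entries of `A` in the eigenbasis of `As`, in terms of the eigenvalues and of the
split sequence. -/
theorem a_eq (i : ℕ) (hi : i ≤ d) :
    F.a i = G.e i + F.splitCoeff G i / (F.e i - F.e (i - 1)) +
      F.splitCoeff G (i + 1) / (F.e i - F.e (i + 1)) := by
  have hg := X_splitVec_ne F G i hi
  -- the last term, also when `i = d`
  have h1 : F.splitCoeff G (i + 1) / (F.e i - F.e (i + 1)) =
      F.X i (F.splitVec G (i + 1)) / F.X i (F.splitVec G i) := by
    by_cases h : i < d
    · have := F.sub_ne hi (show i + 1 ≤ d by omega) (by omega)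
      simp only [splitCoeff]
      field_simp
    · rw [splitCoeff_of_lt F G _ (by omega), splitVec_of_lt F G _ (by omega)]
      simp
  rw [h1]
  have h2 := congrArg (F.X i) (A_splitVec F G i)
  simp only [map_add, map_smul, smul_eq_mul] at h2
  rcases i with _ | i
  · rw [F.X_tri_zero, X_splitVec_of_lt F G 0 1 (by omega)] at h2
    simp only [splitCoeff]
    field_simp
    linear_combination h2
  · rw [F.X_tri_succ i (by omega), X_splitVec_of_lt F G (i + 1) (i + 2) (by omega)] at h2
    have h3 := X_splitVec_ne F G i (by omega)
    have h4 := F.sub_ne (show i + 1 ≤ d by omega) (show i ≤ d by omega) (by omega)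
    have h5 := X_splitVec_succ F G i (by omega)
    have h6 : F.splitCoeff G (i + 1) / (F.e (i + 1) - F.e (i + 1 - 1)) =
        - F.X i (F.splitVec G (i + 1)) / F.X i (F.splitVec G i) := by
      simp only [splitCoeff, Nat.add_sub_cancel]
      field_simp
      ring
    rw [h6]
    rw [h5] at hg h2 ⊢
    have hc := F.c_ne i (by omega)
    field_simp
    linear_combination h2

end Split

end TriFrame

/-! ### The dual split basis and the tridiagonal relation -/

namespace TriFrame

variable {K : Type u} [Field K] {V : Type v} [AddCommGroup V] [Module K V] {d : ℕ}
  {A As : Module.End K V} (F : TriFrame d A As) (G : TriFrame d As A)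

/-- The coordinates of the dual split basis `(As - θs 0) ⋯ (As - θs (i - 1)) w`, where `w` spans
`E 0 V`. -/
theorem X_dual_splitVec (i j : ℕ) :
    F.X j (G.splitVec F i) = (∏ h ∈ Finset.range i, (F.e j - F.e h)) * F.X j G.v := by
  induction i with
  | zero => simp [splitVec]
  | succ i ih =>
    simp only [splitVec, map_sub, map_smul, F.X_diag, smul_eq_mul, ih, Finset.prod_range_succ]
    ring

/-- The components of a vector in `E 0 V` in the spaces `Es j V` do not vanish. -/
theorem X_v_ne_zero (j : ℕ) (hj : j ≤ d) : F.X j G.v ≠ 0 := by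
  have h := Y_splitVec_ne G F j hj
  rw [X_dual_splitVec] at h
  exact right_ne_zero_of_mul h

theorem prod_e_ne {i j : ℕ} (hij : i ≤ j) (hj : j ≤ d) :
    ∏ h ∈ Finset.range i, (F.e j - F.e h) ≠ 0 := by
  refine Finset.prod_ne_zero_iff.2 fun h hh => ?_
  have := Finset.mem_range.1 hh
  exact F.sub_ne hj (by omega) (by omega)

/-- The entries of `A` above the diagonal, in the eigenbasis of `As`, in terms of the dual split
sequence. -/
theorem b_dual (i : ℕ) (hi : i < d) :
    F.b i * ((∏ h ∈ Finset.range (i + 1), (F.e (i + 1) - F.e h)) * F.X (i + 1) G.v) =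
      G.splitCoeff F (i + 1) * ((∏ h ∈ Finset.range i, (F.e i - F.e h)) * F.X i G.v) := by
  have h1 := congrArg (F.X i) (As_splitVec_succ G F i)
  have h0 : F.X i (G.splitVec F (i + 1)) = 0 := Y_splitVec G F (i + 1) i (by omega)
  rw [F.X_tri_bot (Y_splitVec G F (i + 1)) hi.le, map_add, map_smul, map_smul, h0, smul_zero,
    zero_add, X_dual_splitVec, X_dual_splitVec] at h1
  exact h1

/-- The diagonal entries of `A` in the eigenbasis of `As`, in terms of the dual split sequence. -/
theorem a_eq_dual (i : ℕ) (hi : i ≤ d) :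
    F.a i = G.e i + G.splitCoeff F i / (F.e i - F.e (i - 1)) +
      G.splitCoeff F (i + 1) / (F.e i - F.e (i + 1)) := by
  have hx := X_v_ne_zero F G i hi
  have hp := F.prod_e_ne (le_refl i) hi
  -- the contribution of the entry above the diagonal, also when `i = d`
  have h1 : F.b i * F.X (i + 1) (G.splitVec F i) =
      - (G.splitCoeff F (i + 1) / (F.e i - F.e (i + 1))) * F.X i (G.splitVec F i) := by
    by_cases h : i < d
    · have h2 := b_dual F G i h
      have h3 := F.sub_ne hi (show i + 1 ≤ d by omega) (by omega)
      rw [Finset.prod_range_succ] at h2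
      rw [X_dual_splitVec, X_dual_splitVec]
      field_simp
      linear_combination -h2
    · rw [splitCoeff_of_lt G F _ (by omega), F.X_of_lt (i + 1) (by omega)]
      simp
  have h2 := congrArg (F.X i) (As_splitVec G F i)
  simp only [map_add, map_smul, smul_eq_mul] at h2
  rcases i with _ | i
  · rw [F.X_tri_zero, h1] at h2
    simp only [splitVec] at h2
    simp only [splitCoeff] at h2 ⊢
    have : F.X 0 G.v * (F.a 0 - G.e 0 - G.splitCoeff F 1 / (F.e 0 - F.e 1)) = 0 := by
      simp only [splitCoeff]
      linear_combination h2
    have := (mul_eq_zero.1 this).resolve_left hx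
    simp only [splitCoeff] at this
    linear_combination this
  · rw [F.X_tri_succ i (by omega), Y_splitVec G F (i + 1) i (by omega), h1] at h2
    have h3 := F.sub_ne (show i + 1 ≤ d by omega) (show i ≤ d by omega) (by omega)
    simp only [Nat.add_sub_cancel] at h2 ⊢
    have h4 : F.X (i + 1) (G.splitVec F (i + 1)) =
        (F.e (i + 1) - F.e i) * F.X (i + 1) (G.splitVec F i) := by
      rw [X_dual_splitVec, X_dual_splitVec, Finset.prod_range_succ]
      ring
    have h5 : F.X (i + 1) (G.splitVec F (i + 1)) ≠ 0 := by
      rw [X_dual_splitVec]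
      exact mul_ne_zero hp hx
    refine mul_right_cancel₀ h5 ?_
    have h6 : G.splitCoeff F (i + 1) / (F.e (i + 1) - F.e i) *
        F.X (i + 1) (G.splitVec F (i + 1)) =
        G.splitCoeff F (i + 1) * F.X (i + 1) (G.splitVec F i) := by
      rw [h4]
      field_simp
    linear_combination h2 - h6

/-- A sequence of scalars is determined by the diagonal entries of `A` that it yields. -/
theorem splitCoeff_unique {s t : ℕ → K} (h0 : s 0 = t 0)
    (h : ∀ i < d, s i / (F.e i - F.e (i - 1)) + s (i + 1) / (F.e i - F.e (i + 1)) =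
      t i / (F.e i - F.e (i - 1)) + t (i + 1) / (F.e i - F.e (i + 1))) :
    ∀ i ≤ d, s i = t i := by
  intro i
  induction i with
  | zero => exact fun _ => h0
  | succ i ih =>
    intro hi
    have h1 := h i (by omega)
    rw [ih (by omega), add_right_inj] at h1
    exact (div_left_inj' (F.sub_ne (show i ≤ d by omega) hi (by omega))).1 h1

/-- A Leonard system and its dual have the same first split sequence. -/
theorem splitCoeff_dual (i : ℕ) : G.splitCoeff F i = F.splitCoeff G i := by
  by_cases hi : i ≤ d
  · refine F.splitCoeff_unique (s := G.splitCoeff F) (t := F.splitCoeff G) rfl (fun i hi => ?_) i hi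
    have h1 := a_eq F G i hi.le
    rw [a_eq_dual F G i hi.le] at h1
    linear_combination h1
  · rw [splitCoeff_of_lt G F i (by omega), splitCoeff_of_lt F G i (by omega)]

/-- A polynomial in `A` of degree at most `k` maps `Es 0 V` into `Es 0 V + ⋯ + Es k V`, and its
coefficient of degree `k` is visible in the last component. -/
theorem X_aeval (p : Polynomial K) (k : ℕ) (hp : p.natDegree ≤ k) :
    (∀ j, k < j → F.X j (Polynomial.aeval A p F.v) = 0) ∧
      (k ≤ d → F.X k (Polynomial.aeval A p F.v) =
        p.coeff k * F.X k (F.splitVec G k)) := by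
  have h0 : ∀ n, (∀ j, n < j → F.X j ((A ^ n) F.v) = 0) ∧
      (n ≤ d → F.X n ((A ^ n) F.v) = F.X n (F.splitVec G n)) := by
    intro n
    induction n with
    | zero => exact ⟨X_splitVec_of_lt F G 0, fun _ => rfl⟩
    | succ n ih =>
      rw [pow_succ']
      refine ⟨fun j hj => F.X_tri_of_lt ih.1 hj, fun hn => ?_⟩
      rw [X_splitVec_succ F G n hn, ← ih.2 (by omega)]
      exact F.X_tri_top ih.1 hn
  rw [Polynomial.aeval_eq_sum_range' (Nat.lt_succ_of_le hp)]
  simp only [LinearMap.sum_apply, map_sum, LinearMap.smul_apply, map_smul, smul_eq_mul]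
  constructor
  · intro j hj
    refine Finset.sum_eq_zero fun n hn => ?_
    have := Finset.mem_range.1 hn
    rw [(h0 n).1 j (by omega), mul_zero]
  · intro hk
    rw [Finset.sum_range_succ, (h0 k).2 hk, Finset.sum_eq_zero, zero_add]
    intro n hn
    have := Finset.mem_range.1 hn
    rw [(h0 n).1 k (by omega), mul_zero]

theorem Y_aeval (p : Polynomial K) (j : ℕ) (x : V) :
    G.X j (Polynomial.aeval A p x) = p.eval (G.e j) * G.X j x := by
  induction p using Polynomial.induction_on' with
  | add p q hp hq => simp [hp, hq, add_mul]
  | monomial n a =>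
    have : G.X j ((A ^ n) x) = G.e j ^ n * G.X j x := by
      induction n with
      | zero => simp
      | succ n ih => rw [pow_succ', Module.End.mul_apply, G.X_diag, ih]; ring
    simp [Polynomial.aeval_monomial, Module.algebraMap_end_apply, this, mul_assoc]

/-- If `p (θ i) - p (θ (i + 1)) = θ i ^ 2 * θ (i + 1) - θ i * θ (i + 1) ^ 2` for all `i < d`, then
`A ^ 2 As A - A As A ^ 2 = p(A) As - As p(A)`: in an eigenbasis of `A` both sides have zero
diagonal, and on the neighbouring diagonals the entries of `As` are multiplied by these numbers. -/
theorem relation_of_eval (p : Polynomial K)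
    (hp : ∀ i < d, p.eval (G.e i) - p.eval (G.e (i + 1)) =
      G.e i ^ 2 * G.e (i + 1) - G.e i * G.e (i + 1) ^ 2) (x : V) :
    A (A (As (A x))) - A (As (A (A x))) =
      Polynomial.aeval A p (As x) - As (Polynomial.aeval A p x) := by
  rw [← sub_eq_zero]
  refine G.ext_zero _ fun j hj => ?_
  rcases j with _ | j
  · simp only [map_sub, G.X_diag, Y_aeval, G.X_tri_zero]
    by_cases h0 : 0 < d
    · linear_combination - G.b 0 * G.X 1 x * hp 0 h0
    · rw [G.X_of_lt 1 (by omega)]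
      simp only [LinearMap.zero_apply]
      ring
  · have hjd : j < d := by omega
    simp only [map_sub, G.X_diag, Y_aeval, G.X_tri_succ j hjd]
    by_cases h0 : j + 1 < d
    · linear_combination - G.b (j + 1) * G.X (j + 2) x * hp (j + 1) h0 +
        G.c j * G.X j x * hp j hjd
    · rw [G.X_of_lt (j + 2) (by omega)]
      simp only [LinearMap.zero_apply]
      linear_combination G.c j * G.X j x * hp j hjd

end TriFrame

theorem exists_polynomial_eval_sub {K : Type u} [Field K] (d : ℕ) (e r : ℕ → K)
    (he : ∀ i ≤ d, ∀ j ≤ d, e i = e j → i = j) :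
    ∃ p : Polynomial K, p.natDegree ≤ d ∧
      ∀ i < d, p.eval (e i) - p.eval (e (i + 1)) = r i := by
  have hinj : Set.InjOn e (Finset.range (d + 1)) := by
    intro i hi j hj h
    simp only [Finset.coe_range, Set.mem_Iio] at hi hj
    exact he i (by omega) j (by omega) h
  refine ⟨Lagrange.interpolate (Finset.range (d + 1)) e
    (fun i => - ∑ h ∈ Finset.range i, r h), ?_, fun i hi => ?_⟩
  · refine Polynomial.natDegree_le_of_degree_le ?_
    have := Lagrange.degree_interpolate_le (fun i => - ∑ h ∈ Finset.range i, r h) hinj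
    simpa using this
  · rw [Lagrange.eval_interpolate_at_node _ hinj (by simp; omega),
      Lagrange.eval_interpolate_at_node _ hinj (by simp; omega), Finset.sum_range_succ]
    ring

namespace TriFrame

variable {K : Type u} [Field K] {V : Type v} [AddCommGroup V] [Module K V] {d : ℕ}
  {A As : Module.End K V}

/-- The polynomial in `relation_of_eval` has degree at most three: otherwise its leading term would
produce, on a vector in `Es 0 V`, a component in `Es k V` with `k > 3`. -/
theorem natDegree_le_three (F : TriFrame d A As) (G : TriFrame d As A)
    (p : Polynomial K) (hd : p.natDegree ≤ d)
    (hrel : ∀ x : V, A (A (As (A x))) - A (As (A (A x))) =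
      Polynomial.aeval A p (As x) - As (Polynomial.aeval A p x)) : p.natDegree ≤ 3 := by
  by_contra! hk
  set k := p.natDegree with hkdef
  have h1 := congrArg (F.X k) (hrel F.v)
  have hAs : ∀ {x : V} {m : ℕ}, (∀ j, m < j → F.X j x = 0) → ∀ j, m < j → F.X j (As x) = 0 :=
    fun hx j hj => by rw [F.X_diag, hx j hj, mul_zero]
  have hA : ∀ {x : V} {m : ℕ}, (∀ j, m < j → F.X j x = 0) → ∀ j, m + 1 < j → F.X j (A x) = 0 :=
    fun hx j hj => F.X_tri_of_lt hx hj
  have hv : ∀ j, 0 < j → F.X j F.v = 0 := X_splitVec_of_lt F G 0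
  have hAsv : As F.v = F.e 0 • F.v := As_splitVec_zero F G
  rw [map_sub, hA (hA (hAs (hA hv))) k (by omega), hA (hAs (hA (hA hv))) k (by omega), map_sub,
    hAsv, map_smul, map_smul, F.X_diag, (F.X_aeval G p k le_rfl).2 hd, smul_eq_mul] at h1
  have h2 : (F.e 0 - F.e k) * (p.coeff k * F.X k (F.splitVec G k)) = 0 := by
    linear_combination -h1
  have h3 : p.coeff k ≠ 0 := by
    have : p ≠ 0 := by rintro rfl; simp [hkdef] at hk
    simpa [hkdef] using this
  exact mul_ne_zero (F.sub_ne (Nat.zero_le d) hd (by omega))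
    (mul_ne_zero h3 (X_splitVec_ne F G k hd)) h2

/-- The tridiagonal relation: `A ^ 2 As A - A As A ^ 2` is the commutator of a polynomial of degree
at most three in `A` with `As`. -/
theorem exists_relation (F : TriFrame d A As) (G : TriFrame d As A) : ∃ c b a : K,
    (∀ i < d, c * (G.e i ^ 2 + G.e i * G.e (i + 1) + G.e (i + 1) ^ 2) +
      b * (G.e i + G.e (i + 1)) + a = G.e i * G.e (i + 1)) ∧
    ∀ x : V, A (A (As (A x))) - A (As (A (A x))) =
      c • (A (A (A (As x))) - As (A (A (A x)))) + b • (A (A (As x)) - As (A (A x))) +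
        a • (A (As x) - As (A x)) := by
  obtain ⟨p, hd, hp⟩ := exists_polynomial_eval_sub d G.e
    (fun i => G.e i ^ 2 * G.e (i + 1) - G.e i * G.e (i + 1) ^ 2) G.e_inj
  have hrel := relation_of_eval G p hp
  have h3 := F.natDegree_le_three G p hd hrel
  have hlt : p.natDegree < 4 := by omega
  refine ⟨p.coeff 3, p.coeff 2, p.coeff 1, fun i hi => ?_, fun x => ?_⟩
  · have h := hp i hi
    rw [Polynomial.eval_eq_sum_range' hlt, Polynomial.eval_eq_sum_range' hlt] at h
    simp only [Finset.sum_range_succ, Finset.sum_range_zero] at h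
    refine mul_left_cancel₀ (G.sub_ne (show i ≤ d by omega) (show i + 1 ≤ d by omega)
      (by omega)) ?_
    linear_combination h
  · rw [hrel, Polynomial.aeval_eq_sum_range' hlt]
    simp only [Finset.sum_range_succ, Finset.sum_range_zero, LinearMap.add_apply,
      LinearMap.smul_apply, LinearMap.zero_apply, pow_succ, pow_zero, one_mul,
      Module.End.mul_apply, Module.End.one_apply, map_add, map_smul, map_zero]
    module

end TriFrame

/-! ### The recurrences and their explicit solution -/

/-- The coefficients of `u 2` and `u 3` in the tridiagonal relation applied to `u 0`, where `A`
raises and `As` lowers; `f` is a linear functional that vanishes on the earlier vectors. -/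
theorem split_relation_apply {K : Type u} [Field K] {V : Type v} [AddCommGroup V] [Module K V]
    {A As : Module.End K V} {c b a t θ₀ θ₁ θ₂ s₀ s₁ s₂ s₃ φ₀ φ₁ φ₂ φ₃ : K} {z u₀ u₁ u₂ u₃ : V}
    (hrel : A (A (As (A u₀))) - A (As (A (A u₀))) =
      c • (A (A (A (As u₀))) - As (A (A (A u₀)))) + b • (A (A (As u₀)) - As (A (A u₀))) +
        a • (A (As u₀) - As (A u₀)))
    (hAz : A z = t • z + φ₀ • u₀) (hA₀ : A u₀ = θ₀ • u₀ + u₁) (hA₁ : A u₁ = θ₁ • u₁ + u₂)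
    (hA₂ : A u₂ = θ₂ • u₂ + u₃) (hs₀ : As u₀ = s₀ • u₀ + z) (hs₁ : As u₁ = s₁ • u₁ + φ₁ • u₀)
    (hs₂ : As u₂ = s₂ • u₂ + φ₂ • u₁) (hs₃ : As u₃ = s₃ • u₃ + φ₃ • u₂)
    (f : V →ₗ[K] K) (hz : f z = 0) (h₀ : f u₀ = 0) (h₁ : f u₁ = 0) :
    (s₁ - s₂ - c * (s₀ - s₃)) * f u₃ +
      (φ₁ - φ₂ - c * (φ₀ - φ₃) + s₁ * (θ₂ - θ₀) + θ₀ * s₀ - θ₂ * s₂ -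
        (s₀ - s₂) * (c * (θ₀ + θ₁ + θ₂) + b)) * f u₂ = 0 := by
  simp only [map_add, map_smul, hA₀, hA₁, hA₂, hs₀, hs₁, hs₂, hs₃, hAz, smul_add] at hrel
  have h := congrArg f hrel
  simp only [map_add, map_sub, map_smul, smul_eq_mul, hz, h₀, h₁] at h
  linear_combination h

namespace TriFrame

variable {K : Type u} [Field K] {V : Type v} [AddCommGroup V] [Module K V] {d : ℕ}
  {A As : Module.End K V}

/-- The recurrences for the eigenvalues, the dual eigenvalues and the first split sequence. -/
theorem exists_recurrence (F : TriFrame d A As) (G : TriFrame d As A) : ∃ c b : K,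
    (∀ i, i + 2 ≤ d → c * (G.e i + G.e (i + 1) + G.e (i + 2)) + b = G.e (i + 1)) ∧
    (∀ i, i + 3 ≤ d → F.e (i + 1) - F.e (i + 2) = c * (F.e i - F.e (i + 3))) ∧
    ∀ i, i + 2 ≤ d →
      F.splitCoeff G (i + 1) - F.splitCoeff G (i + 2) -
          c * (F.splitCoeff G i - F.splitCoeff G (i + 3)) =
        (F.e i - F.e (i + 2)) * G.e (i + 1) - F.e (i + 1) * (G.e (i + 2) - G.e i) -
          G.e i * F.e i + G.e (i + 2) * F.e (i + 2) := by
  obtain ⟨c, b, a, h1, h2⟩ := F.exists_relation G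
  have hθ : ∀ i, i + 2 ≤ d → c * (G.e i + G.e (i + 1) + G.e (i + 2)) + b = G.e (i + 1) := by
    intro i hi
    refine mul_left_cancel₀ (G.sub_ne (show i ≤ d by omega) hi (by omega)) ?_
    linear_combination h1 i (by omega) - h1 (i + 1) (by omega)
  have key : ∀ i, i + 2 ≤ d → ∀ n, i + 2 ≤ n →
      (F.e (i + 1) - F.e (i + 2) - c * (F.e i - F.e (i + 3))) * F.X n (F.splitVec G (i + 3)) +
      (F.splitCoeff G (i + 1) - F.splitCoeff G (i + 2) -
        c * (F.splitCoeff G i - F.splitCoeff G (i + 3)) + F.e (i + 1) * (G.e (i + 2) - G.e i) +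
        G.e i * F.e i - G.e (i + 2) * F.e (i + 2) -
        (F.e i - F.e (i + 2)) * (c * (G.e i + G.e (i + 1) + G.e (i + 2)) + b)) *
          F.X n (F.splitVec G (i + 2)) = 0 := fun i _ n hn => by
    obtain ⟨z, t, hAz, hs, hfz⟩ : ∃ (z : V) (t : K),
        A z = t • z + F.splitCoeff G i • F.splitVec G i ∧
        As (F.splitVec G i) = F.e i • F.splitVec G i + z ∧ F.X n z = 0 := by
      rcases i with _ | i
      · exact ⟨0, 0, by simp [splitCoeff], by simp [As_splitVec_zero], map_zero _⟩
      · refine ⟨F.splitCoeff G (i + 1) • F.splitVec G i, G.e i, ?_, As_splitVec_succ F G i, ?_⟩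
        · rw [map_smul, A_splitVec F G i, smul_add, smul_comm]
        · rw [map_smul, X_splitVec_of_lt F G i n (by omega), smul_zero]
    exact split_relation_apply (h2 (F.splitVec G i)) hAz (A_splitVec F G i)
      (A_splitVec F G (i + 1)) (A_splitVec F G (i + 2)) hs (As_splitVec_succ F G i)
      (As_splitVec_succ F G (i + 1)) (As_splitVec_succ F G (i + 2)) (F.X n) hfz
      (X_splitVec_of_lt F G i n (by omega)) (X_splitVec_of_lt F G (i + 1) n (by omega))
  have hs : ∀ i, i + 3 ≤ d → F.e (i + 1) - F.e (i + 2) = c * (F.e i - F.e (i + 3)) := by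
    intro i hi
    have h := key i (by omega) (i + 3) (by omega)
    rw [X_splitVec_of_lt F G (i + 2) (i + 3) (by omega), mul_zero, add_zero] at h
    exact sub_eq_zero.1 ((mul_eq_zero.1 h).resolve_right (X_splitVec_ne F G (i + 3) hi))
  refine ⟨c, b, hθ, hs, fun i hi => ?_⟩
  have h := key i hi (i + 2) le_rfl
  have h3 : (F.e (i + 1) - F.e (i + 2) - c * (F.e i - F.e (i + 3))) *
      F.X (i + 2) (F.splitVec G (i + 3)) = 0 := by
    by_cases hd : i + 3 ≤ d
    · rw [hs i hd, sub_self, zero_mul]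
    · rw [splitVec_of_lt F G (i + 3) (by omega), map_zero, mul_zero]
  rw [h3, zero_add, hθ i hi] at h
  linear_combination (mul_eq_zero.1 h).resolve_right (X_splitVec_ne F G (i + 2) hi)

end TriFrame

section Recurrence

variable {K : Type u} [Field K] {d : ℕ}

/-- A solution of the recurrence of the split sequence with four zeros at the boundary vanishes.
Otherwise `1`, `δ i` and `δ (i + 1)` span the solutions, which include `θ`, and then `θ 0 = θ d`. -/
theorem eq_zero_of_recurrence {c : K} {θ δ : ℕ → K} (hd : 1 ≤ d) (h0d : θ 0 ≠ θ d)
    (hc : 3 ≤ d → c ≠ 0)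
    (hθ : ∀ i, i + 3 ≤ d → θ (i + 1) - θ (i + 2) = c * (θ i - θ (i + 3)))
    (hδ : ∀ i, i + 2 ≤ d → δ (i + 1) - δ (i + 2) = c * (δ i - δ (i + 3)))
    (h0 : δ 0 = 0) (h1 : δ 1 = 0) (hdd : δ d = 0) (hd1 : δ (d + 1) = 0) :
    ∀ i ≤ d, δ i = 0 := by
  have h2 : δ 2 = 0 := by
    rcases Nat.lt_or_ge d 3 with hd3 | hd3
    · obtain rfl | rfl : d = 1 ∨ d = 2 := by omega
      exacts [hd1, hdd]
    by_contra h2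
    have hc := hc hd3
    set q := (θ 1 - θ 0) / δ 2 with hq
    set r := (θ 2 - θ 0 - q * δ 3) / δ 2 with hr
    have key : ∀ i, i ≤ d → θ i = θ 0 + r * δ i + q * δ (i + 1) := by
      intro i
      induction i using Nat.strong_induction_on with
      | _ i ih =>
        intro hi
        rcases i with _ | _ | _ | i
        · simp [h0, h1]
        · rw [h1, hq]; field_simp; ring
        · rw [hr]; field_simp; ring
        · have e0 := ih i (by omega) (by omega)
          have e1 := ih (i + 1) (by omega) (by omega)
          have e2 := ih (i + 2) (by omega) (by omega)
          have f0 := hθ i hi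
          have f1 := hδ i (by omega)
          have f2 := hδ (i + 1) (by omega)
          refine mul_left_cancel₀ hc ?_
          linear_combination f0 + c * e0 - e1 + e2 - r * f1 - q * f2
    have := key d le_rfl
    rw [hdd, hd1] at this
    exact h0d (by linear_combination -this)
  intro i
  induction i using Nat.strong_induction_on with
  | _ i ih =>
    intro hi
    rcases i with _ | _ | _ | i
    · exact h0
    · exact h1
    · exact h2
    · have f1 := hδ i (by omega)
      rw [ih i (by omega) (by omega), ih (i + 1) (by omega) (by omega),
        ih (i + 2) (by omega) (by omega)] at f1
      have : c * δ (i + 3) = 0 := by linear_combination f1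
      exact (mul_eq_zero.1 this).resolve_left (hc (by omega))

/-- The explicit solution of the recurrence of the split sequence. -/
theorem eq_of_recurrence {c b κ : K} {θ s φ : ℕ → K} (hd : 1 ≤ d) (h0d : θ 0 ≠ θ d)
    (hs12 : 3 ≤ d → s 1 ≠ s 2)
    (hθ : ∀ i, i + 2 ≤ d → c * (θ i + θ (i + 1) + θ (i + 2)) + b = θ (i + 1))
    (hs : ∀ i, i + 3 ≤ d → s (i + 1) - s (i + 2) = c * (s i - s (i + 3)))
    (hφ : ∀ i, i + 2 ≤ d → φ (i + 1) - φ (i + 2) - c * (φ i - φ (i + 3)) =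
      (s i - s (i + 2)) * θ (i + 1) - s (i + 1) * (θ (i + 2) - θ i) - θ i * s i +
        θ (i + 2) * s (i + 2))
    (h0 : φ 0 = 0) (hd1 : φ (d + 1) = 0)
    (h1 : φ 1 = κ + (s 1 - s 0) * (θ 0 - θ d))
    (hdd : φ d = κ + (s d - s 0) * (θ (d - 1) - θ d)) :
    ∀ i < d, φ (i + 1) = κ * (∑ h ∈ Finset.range (i + 1), (θ h - θ (d - h)) / (θ 0 - θ d)) +
      (s (i + 1) - s 0) * (θ i - θ d) := by
  have hne : θ 0 - θ d ≠ 0 := sub_ne_zero.2 h0d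
  have hθ3 : ∀ i, i + 3 ≤ d → θ (i + 1) - θ (i + 2) = c * (θ i - θ (i + 3)) := by
    intro i hi
    linear_combination hθ (i + 1) hi - hθ i (by omega)
  set S : ℕ → K := fun i => ∑ h ∈ Finset.range i, (θ h - θ (d - h)) / (θ 0 - θ d) with hS
  have hS1 : ∀ i, S (i + 1) = S i + (θ i - θ (d - i)) / (θ 0 - θ d) := fun i =>
    Finset.sum_range_succ _ _
  have hS0 : S 0 = 0 := by simp [hS]
  have hSd1 : S (d + 1) = 0 := by
    have : S (d + 1) = ∑ h ∈ Finset.range (d + 1), θ h / (θ 0 - θ d) -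
        ∑ h ∈ Finset.range (d + 1), θ (d + 1 - 1 - h) / (θ 0 - θ d) := by
      rw [← Finset.sum_sub_distrib]
      exact Finset.sum_congr rfl fun h _ => by rw [Nat.add_sub_cancel, sub_div]
    rw [this, Finset.sum_range_reflect (fun h => θ h / (θ 0 - θ d)), sub_self]
  have hSone : S 1 = 1 := by
    rw [hS1, hS0, Nat.sub_zero, div_self hne, zero_add]
  have hSd : S d = 1 := by
    have h := hS1 d
    rw [hSd1, Nat.sub_self, ← neg_sub, neg_div, div_self hne] at h
    linear_combination -h
  have hSrec : ∀ i, i + 2 ≤ d → S (i + 1) - S (i + 2) = c * (S i - S (i + 3)) := by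
    intro i hi
    have e1 := hθ i hi
    have e2 := hθ (d - (i + 2)) (by omega)
    rw [show d - (i + 2) + 1 = d - (i + 1) by omega, show d - (i + 2) + 2 = d - i by omega] at e2
    rw [hS1 (i + 2), hS1 (i + 1), hS1 i]
    field_simp
    linear_combination e1 - e2
  -- the product term, with its value `0` at `i = 0` and at `i = d + 1`
  set P : ℕ → K := fun i => (s i - s 0) * (θ (i - 1) - θ d) with hP
  set δ : ℕ → K := fun i => φ i - κ * S i - P i with hδ
  have hzero := eq_zero_of_recurrence (c := c) (θ := θ) (δ := δ) hd h0d ?_ hθ3 ?_ ?_ ?_ ?_ ?_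
  · intro i hi
    have := hzero (i + 1) hi
    simp only [hδ, hP, hS, Nat.add_sub_cancel] at this
    linear_combination this
  · rintro h rfl
    have := hs 0 h
    rw [zero_mul] at this
    exact hs12 h (sub_eq_zero.1 this)
  · intro i hi
    have e1 := hφ i hi
    have e2 := hSrec i hi
    have e3 : P (i + 1) - P (i + 2) - c * (P i - P (i + 3)) =
        (s i - s (i + 2)) * θ (i + 1) - s (i + 1) * (θ (i + 2) - θ i) - θ i * s i +
          θ (i + 2) * s (i + 2) := by
      have f1 : c * ((s i - s (i + 3)) * (θ (i + 2) - θ d)) =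
          (s (i + 1) - s (i + 2)) * (θ (i + 2) - θ d) := by
        by_cases h : i + 3 ≤ d
        · rw [hs i h]; ring
        · rw [show i + 2 = d by omega]; ring
      have f2 : c * ((s i - s 0) * (θ (i - 1) - θ (i + 2))) =
          (s i - s 0) * (θ i - θ (i + 1)) := by
        rcases i with _ | i
        · ring
        · rw [Nat.add_sub_cancel, hθ3 i hi]; ring
      simp only [hP, Nat.add_sub_cancel, show i + 2 - 1 = i + 1 from rfl,
        show i + 3 - 1 = i + 2 from rfl]
      linear_combination -f1 - f2
    simp only [hδ]
    linear_combination e1 - κ * e2 - e3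
  · simp [hδ, hP, hS0, h0]
  · simp only [hδ, hP, hSone, h1]; ring
  · simp only [hδ, hP, hSd, hdd]; ring
  · simp only [hδ, hP, hSd1, hd1, Nat.add_sub_cancel]; ring

end Recurrence

/-! ### Irreducible modules of a matrix algebra and eigenbases -/

section Representation

open scoped Matrix

variable {K : Type u} [Field K] {𝓐 : Type v} [Ring 𝓐] [Algebra K 𝓐] {d : ℕ}

/-- A matrix algebra acts on each of its irreducible modules `V` as the full algebra `End V`. -/
theorem IsMatrixAlgebra.exists_algEquiv_end (h : IsMatrixAlgebra K d 𝓐) (V : Type w)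
    [AddCommGroup V] [Module K V] [Module 𝓐 V] [IsScalarTower K 𝓐 V] [IsSimpleModule 𝓐 V] :
    Module.finrank K V = d + 1 ∧
      ∃ ρ : 𝓐 ≃ₐ[K] Module.End K V, ∀ a x, ρ a x = a • x := by
  obtain ⟨e⟩ := h
  have : Nontrivial V := IsSimpleModule.nontrivial 𝓐 V
  obtain ⟨x, hx⟩ := exists_ne (0 : V)
  -- some diagonal matrix unit does not annihilate `x`
  obtain ⟨i₀, hi₀⟩ : ∃ i, e.symm (Matrix.single i i 1) • x ≠ 0 := by
    by_contra! h
    apply hx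
    rw [← one_smul 𝓐 x, ← map_one e.symm, ← Matrix.sum_single_one, map_sum, Finset.sum_smul]
    exact Finset.sum_eq_zero fun i _ => h i
  let f : (Fin (d + 1) → K) →ₗ[K] V :=
    { toFun := fun y => e.symm (Matrix.vecMulVec y (Pi.single i₀ 1)) • x
      map_add' := fun y z => by rw [Matrix.add_vecMulVec, map_add, add_smul]
      map_smul' := fun c y => by
        rw [Matrix.smul_vecMulVec, map_smul, smul_assoc, RingHom.id_apply] }
  have hf : ∀ a y, f (e a *ᵥ y) = a • f y := fun a y => by
    change e.symm (Matrix.vecMulVec (e a *ᵥ y) _) • x = a • e.symm _ • x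
    rw [← Matrix.mul_vecMulVec, map_mul, AlgEquiv.symm_apply_apply, mul_smul]
  have hf₀ : f (Pi.single i₀ 1) ≠ 0 := by
    change e.symm (Matrix.vecMulVec _ _) • x ≠ 0
    rwa [← Matrix.single_eq_single_vecMulVec_single]
  have hbij : Function.Bijective f := by
    constructor
    · rw [injective_iff_map_eq_zero]
      intro y hy
      by_contra hne
      obtain ⟨j, hj⟩ := Function.ne_iff.1 hne
      have h1 := hf (e.symm (Matrix.single i₀ j 1)) y
      rw [hy, smul_zero, AlgEquiv.apply_symm_apply] at h1
      have h2 : Matrix.single i₀ j 1 *ᵥ y = y j • (Pi.single i₀ 1 : Fin (d + 1) → K) := by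
        ext k
        simp [Matrix.single_mulVec, Function.update_apply, Pi.single_apply]
      rw [h2, map_smul] at h1
      exact (smul_ne_zero hj hf₀) h1
    · intro z
      obtain ⟨a, ha⟩ := IsSimpleModule.toSpanSingleton_surjective 𝓐 hf₀ z
      exact ⟨e a *ᵥ Pi.single i₀ 1, by rw [hf]; exact ha⟩
  let g := LinearEquiv.ofBijective f hbij
  refine ⟨by rw [← g.finrank_eq]; simp,
    e.trans (Matrix.toLinAlgEquiv'.trans (g.conjAlgEquiv K)), fun a z => ?_⟩
  change f (e a *ᵥ g.symm z) = a • z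
  rw [hf]
  exact congrArg _ (g.apply_symm_apply z)

/-- An irreducible module in the universe of the algebra: a minimal left ideal. -/
theorem IsMatrixAlgebra.exists_isSimpleModule (h : IsMatrixAlgebra K d 𝓐) :
    ∃ S : Submodule 𝓐 𝓐, IsSimpleModule 𝓐 S := by
  obtain ⟨e⟩ := h
  have : Module.Finite K 𝓐 := Module.Finite.equiv e.symm.toLinearEquiv
  have : IsArtinianRing 𝓐 := IsArtinianRing.of_finite K 𝓐
  have : Nontrivial 𝓐 := e.toEquiv.nontrivial
  obtain ⟨S, hS⟩ := IsAtomic.exists_atom (Submodule 𝓐 𝓐)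
  exact ⟨S, isSimpleModule_iff_isAtom.2 hS⟩

theorem exists_eigenbasis {V : Type w} [AddCommGroup V] [Module K V]
    (hV : Module.finrank K V = d + 1) (ρ : 𝓐 ≃ₐ[K] Module.End K V) {a : 𝓐}
    {θ : Fin (d + 1) → K} (hθ : IsEigenvalueOrdering a θ) :
    ∃ w : Module.Basis (Fin (d + 1)) K V, ∀ i, ρ a (w i) = θ i • w i := by
  have : FiniteDimensional K V := Module.finite_of_finrank_pos (by omega)
  have h : ∀ i, ∃ x, (ρ a).HasEigenvector (θ i) x := fun i => by
    refine Module.End.HasEigenvalue.exists_hasEigenvector ?_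
    rw [Module.End.hasEigenvalue_iff_mem_spectrum, AlgEquiv.spectrum_eq, ← hθ.2]
    exact ⟨i, rfl⟩
  choose w hw using h
  have hli := Module.End.eigenvectors_linearIndependent' (ρ a) θ hθ.1 w hw
  refine ⟨basisOfLinearIndependentOfCardEqFinrank hli (by simp [hV]), fun i => ?_⟩
  rw [coe_basisOfLinearIndependentOfCardEqFinrank]
  exact (hw i).apply_eq_smul

/-- The primitive idempotents act as the coordinate projections of any eigenbasis. -/
theorem apply_primitiveIdempotent {V : Type w} [AddCommGroup V] [Module K V]
    (ρ : 𝓐 ≃ₐ[K] Module.End K V) {a : 𝓐} {θ : Fin (d + 1) → K} (hθ : Function.Injective θ)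
    {w : Module.Basis (Fin (d + 1)) K V} (hw : ∀ i, ρ a (w i) = θ i • w i) (i : Fin (d + 1))
    (x : V) :
    ρ (primitiveIdempotent a θ i) x = w.repr x i • w i := by
  have h : ∀ j, ρ (primitiveIdempotent a θ i) (w j) = if j = i then w i else 0 := fun j => by
    have hev : (ρ a).HasEigenvector (θ j) (w j) :=
      ⟨Module.End.mem_eigenspace_iff.2 (hw j), w.ne_zero j⟩
    rw [primitiveIdempotent, ← Polynomial.aeval_algHom_apply,
      Module.End.aeval_apply_of_hasEigenvector hev]
    split_ifs with hij
    · subst hij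
      rw [Lagrange.eval_basis_self hθ.injOn (Finset.mem_univ _), one_smul]
    · rw [Lagrange.eval_basis_of_ne (Ne.symm hij) (Finset.mem_univ _), zero_smul]
  have hx := congrArg (ρ (primitiveIdempotent a θ i)) (w.sum_repr x)
  rw [← hx, map_sum]
  simp [h]

end Representation

/-! ### Frames from eigenbases -/

/-- A sequence indexed by `0, …, n - 1`, continued by `0`. -/
def natExtend {M : Type*} [Zero M] {n : ℕ} (f : Fin n → M) (j : ℕ) : M :=
  if h : j < n then f ⟨j, h⟩ else 0

section natExtend

variable {M : Type*} [Zero M] {n : ℕ} (f : Fin n → M)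

theorem natExtend_of_lt {j : ℕ} (h : j < n) : natExtend f j = f ⟨j, h⟩ := dif_pos h

theorem natExtend_of_ge {j : ℕ} (h : n ≤ j) : natExtend f j = 0 := dif_neg (by omega)

@[simp]
theorem natExtend_val (i : Fin n) : natExtend f (i : ℕ) = f i := dif_pos i.isLt

end natExtend

section Frame

variable {K : Type u} [Field K] {V : Type v} [AddCommGroup V] [Module K V] {d : ℕ}
  {A As : Module.End K V}

theorem sum_natExtend_coord (v : Module.Basis (Fin (d + 1)) K V) (x : V) :
    ∑ j ∈ Finset.range (d + 1), natExtend v.coord j x • natExtend v j = x := by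
  rw [Finset.sum_range]
  simp [v.sum_repr]

theorem coord_natExtend (v : Module.Basis (Fin (d + 1)) K V) {i : ℕ} (hi : i ≤ d) (j : ℕ) :
    natExtend v.coord j (natExtend v i) = if j = i then 1 else 0 := by
  rw [natExtend_of_lt (v : Fin (d + 1) → V) (Nat.lt_succ_of_le hi)]
  by_cases hj : j < d + 1
  · rw [natExtend_of_lt _ hj, Module.Basis.coord_apply, Module.Basis.repr_self,
      Finsupp.single_apply]
    simp [eq_comm]
  · rw [natExtend_of_ge _ (by omega), if_neg (by omega)]
    rfl

/-- An eigenbasis of `As` with respect to which `A` is irreducible tridiagonal. -/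
structure IsTridiagonalEigenbasis (A As : Module.End K V) (v : Module.Basis (Fin (d + 1)) K V)
    (θs : Fin (d + 1) → K) : Prop where
  injective : Function.Injective θs
  apply_eq : ∀ i, As (v i) = θs i • v i
  eq_zero : ∀ i j : Fin (d + 1), 1 < |(i : ℤ) - (j : ℤ)| → v.coord i (A (v j)) = 0
  ne_zero : ∀ i j : Fin (d + 1), |(i : ℤ) - (j : ℤ)| = 1 → v.coord i (A (v j)) ≠ 0

theorem IsTridiagonalEigenbasis.natExtend_eq_zero {v : Module.Basis (Fin (d + 1)) K V}
    {θs : Fin (d + 1) → K} (h : IsTridiagonalEigenbasis A As v θs) {i j : ℕ}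
    (hij : i + 1 < j ∨ j + 1 < i) :
    natExtend v.coord i (A (natExtend v j)) = 0 := by
  by_cases hi : i < d + 1
  · by_cases hj : j < d + 1
    · rw [natExtend_of_lt _ hi, natExtend_of_lt _ hj]
      refine h.eq_zero _ _ ?_
      rw [lt_abs]
      simp only
      omega
    · rw [natExtend_of_ge (v : Fin (d + 1) → V) (by omega), map_zero, map_zero]
  · rw [natExtend_of_ge _ (by omega)]
    rfl

/-- The coordinates of `A x`, as a sum over any finite set of indices that contains the
neighbours of `i`. -/
theorem IsTridiagonalEigenbasis.coord_apply {v : Module.Basis (Fin (d + 1)) K V}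
    {θs : Fin (d + 1) → K}
    (h : IsTridiagonalEigenbasis A As v θs) (i : ℕ) (s : Finset ℕ)
    (hs : ∀ j, j ≤ i + 1 → i ≤ j + 1 → j ∈ s) (x : V) :
    natExtend v.coord i (A x) =
      ∑ j ∈ s, natExtend v.coord i (A (natExtend v j)) * natExtend v.coord j x := by
  have h1 : natExtend v.coord i (A x) = ∑ j ∈ Finset.range (d + 1),
      natExtend v.coord i (A (natExtend v j)) * natExtend v.coord j x := by
    conv_lhs => rw [← sum_natExtend_coord v x]
    simp only [map_sum, map_smul, smul_eq_mul, mul_comm]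
  have h2 : ∀ t : Finset ℕ, t ⊆ s ∪ Finset.range (d + 1) →
      (∀ j ∈ s ∪ Finset.range (d + 1), j ∉ t → j ∉ s ∨ d < j) →
      ∑ j ∈ t, natExtend v.coord i (A (natExtend v j)) * natExtend v.coord j x =
      ∑ j ∈ s ∪ Finset.range (d + 1),
        natExtend v.coord i (A (natExtend v j)) * natExtend v.coord j x := by
    intro t ht ht'
    refine Finset.sum_subset ht fun j hj hjt => ?_
    rcases ht' j hj hjt with h' | h'
    · rw [h.natExtend_eq_zero, zero_mul]
      by_contra hc
      exact h' (hs j (by omega) (by omega))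
    · rw [natExtend_of_ge v.coord (show d + 1 ≤ j by omega), LinearMap.zero_apply, mul_zero]
  rw [h1, h2 s Finset.subset_union_left (fun j _ hj => Or.inl hj),
    h2 _ Finset.subset_union_right (fun j _ hj => Or.inr (by simpa using hj))]

/-- The frame of coordinates with respect to an eigenbasis of `As`. -/
noncomputable def IsTridiagonalEigenbasis.frame {v : Module.Basis (Fin (d + 1)) K V}
    {θs : Fin (d + 1) → K}
    (h : IsTridiagonalEigenbasis A As v θs) : TriFrame d A As where
  X := natExtend v.coord
  e := natExtend θs
  a := fun i => natExtend v.coord i (A (natExtend v i))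
  b := fun i => natExtend v.coord i (A (natExtend v (i + 1)))
  c := fun i => natExtend v.coord (i + 1) (A (natExtend v i))
  v := v 0
  X_of_lt := fun j hj => natExtend_of_ge _ hj
  ext_zero := fun x hx => by
    rw [← sum_natExtend_coord v x]
    refine Finset.sum_eq_zero fun j hj => ?_
    rw [hx j (by simpa [Nat.lt_succ_iff] using hj), zero_smul]
  e_inj := fun i hi j hj hij => by
    rw [natExtend_of_lt _ (Nat.lt_succ_of_le hi), natExtend_of_lt _ (Nat.lt_succ_of_le hj)] at hij
    simpa using h.injective hij
  X_diag := fun j x => by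
    by_cases hj : j < d + 1
    · rw [natExtend_of_lt _ hj, natExtend_of_lt _ hj]
      have hx := congrArg (fun y => v.coord ⟨j, hj⟩ (As y)) (v.sum_repr x)
      simp only [map_sum, map_smul, h.apply_eq] at hx
      rw [← hx]
      simp [Finsupp.single_apply, mul_comm]
    · rw [natExtend_of_ge v.coord (by omega)]
      simp
  X_tri_zero := fun x => by
    rw [h.coord_apply 0 {0, 1} (by intro j; simp; omega), Finset.sum_pair (by omega)]
  X_tri_succ := fun i _ x => by
    rw [h.coord_apply (i + 1) {i, i + 1, i + 2} (by intro j; simp; omega),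
      Finset.sum_insert (by simp), Finset.sum_pair (by omega), add_assoc]
  b_ne := fun j hj => by
    rw [natExtend_of_lt v.coord (by omega),
      natExtend_of_lt (v : Fin (d + 1) → V) (show j + 1 < d + 1 by omega)]
    exact h.ne_zero _ _ (by simp)
  c_ne := fun j hj => by
    rw [natExtend_of_lt v.coord (show j + 1 < d + 1 by omega),
      natExtend_of_lt (v : Fin (d + 1) → V) (show j < d + 1 by omega)]
    exact h.ne_zero _ _ (by simp)
  X_v_zero := by
    rw [natExtend_of_lt v.coord (by omega)]
    simp
  X_v_succ := fun j => by
    have := coord_natExtend v (Nat.zero_le d) (j + 1)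
    rw [natExtend_of_lt (v : Fin (d + 1) → V) (by omega)] at this
    simpa using this

end Frame

/-! ### The first split sequence in terms of the corners `Es i A Es i` -/

section Systems

variable {K : Type u} [Field K] {𝓐 : Type v} [Ring 𝓐] [Algebra K 𝓐] {d : ℕ}

/-- The numbers `θ i + φ i / (θs i - θs (i - 1)) + φ (i + 1) / (θs i - θs (i + 1))`, for sequences
with `φ 0 = 0` and `φ (d + 1) = 0`. At `i = 0` the second term is `φ 0 / 0 = 0`. -/
def diagEntry (θ θs φ : ℕ → K) (i : ℕ) : K :=
  θ i + φ i / (θs i - θs (i - 1)) + φ (i + 1) / (θs i - θs (i + 1))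

/-- The sequence `0, φ 1, …, φ d, 0, …`, where `φ (j + 1)` is given as `φ j`. -/
def splitExtend (φ : Fin d → K) : ℕ → K
  | 0 => 0
  | n + 1 => natExtend φ n

section Representation

variable {V : Type w} [AddCommGroup V] [Module K V] (ρ : 𝓐 ≃ₐ[K] Module.End K V)

theorem IsEigenvalueSequence.apply_eq {a : 𝓐} {E : Fin (d + 1) → 𝓐} {θ : Fin (d + 1) → K}
    (h : IsEigenvalueSequence a E θ) {w : Module.Basis (Fin (d + 1)) K V}
    (hw : ∀ i, ρ a (w i) = θ i • w i) (i : Fin (d + 1)) (x : V) :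
    ρ (E i) x = w.coord i x • w i := by
  rw [h.2 i]
  exact apply_primitiveIdempotent ρ h.1.1 hw i x

theorem IsEigenvalueSequence.ne_zero {a : 𝓐} {E : Fin (d + 1) → 𝓐} {θ : Fin (d + 1) → K}
    (h : IsEigenvalueSequence a E θ) {w : Module.Basis (Fin (d + 1)) K V}
    (hw : ∀ i, ρ a (w i) = θ i • w i) (i : Fin (d + 1)) : E i ≠ 0 := by
  intro h0
  have := h.apply_eq ρ hw i (w i)
  rw [h0] at this
  simp [(w.ne_zero i).symm] at this

theorem IsEigenvalueSequence.mul_mul_eq_zero_iff {a : 𝓐} {E : Fin (d + 1) → 𝓐}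
    {θ : Fin (d + 1) → K} (h : IsEigenvalueSequence a E θ) {w : Module.Basis (Fin (d + 1)) K V}
    (hw : ∀ i, ρ a (w i) = θ i • w i) (b : 𝓐) (i j : Fin (d + 1)) :
    E i * b * E j = 0 ↔ w.coord i (ρ b (w j)) = 0 := by
  have key : ∀ x, ρ (E i * b * E j) x = (w.coord j x * w.coord i (ρ b (w j))) • w i := by
    intro x
    rw [map_mul, map_mul, Module.End.mul_apply, Module.End.mul_apply, h.apply_eq ρ hw,
      h.apply_eq ρ hw, map_smul, map_smul, smul_eq_mul]
  constructor
  · intro h0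
    have := key (w j)
    rw [h0] at this
    simpa [w.ne_zero i] using this.symm
  · intro h0
    refine (map_eq_zero_iff ρ ρ.injective).1 (LinearMap.ext fun x => ?_)
    rw [key, h0, mul_zero, zero_smul, LinearMap.zero_apply]

/-- The corner `E i b E i` is spanned by `E i`. -/
theorem IsEigenvalueSequence.mul_mul_eq_smul {a : 𝓐} {E : Fin (d + 1) → 𝓐}
    {θ : Fin (d + 1) → K} (h : IsEigenvalueSequence a E θ) {w : Module.Basis (Fin (d + 1)) K V}
    (hw : ∀ i, ρ a (w i) = θ i • w i) (b : 𝓐) (i : Fin (d + 1)) :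
    E i * b * E i = w.coord i (ρ b (w i)) • E i := by
  refine ρ.injective (LinearMap.ext fun x => ?_)
  rw [map_mul, map_mul, map_smul, Module.End.mul_apply, Module.End.mul_apply, LinearMap.smul_apply,
    h.apply_eq ρ hw, h.apply_eq ρ hw, map_smul, map_smul, smul_eq_mul, smul_smul, mul_comm]

theorem IsIdempotentSequence.isTridiagonalEigenbasis {a b : 𝓐} {E : Fin (d + 1) → 𝓐}
    {θ : Fin (d + 1) → K} (hE : IsIdempotentSequence K a b E) (h : IsEigenvalueSequence a E θ)
    {w : Module.Basis (Fin (d + 1)) K V} (hw : ∀ i, ρ a (w i) = θ i • w i) :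
    IsTridiagonalEigenbasis (ρ b) (ρ a) w θ where
  injective := h.1.1
  apply_eq := hw
  eq_zero := fun i j hij => (h.mul_mul_eq_zero_iff ρ hw b i j).1 ((hE.2 i j).1 hij)
  ne_zero := fun i j hij => fun h0 =>
    (hE.2 i j).2 hij ((h.mul_mul_eq_zero_iff ρ hw b i j).2 h0)

end Representation

theorem IsMatrixAlgebra.exists_rep (h : IsMatrixAlgebra K d 𝓐) :
    Module.finrank K (Fin (d + 1) → K) = d + 1 ∧
      Nonempty (𝓐 ≃ₐ[K] Module.End K (Fin (d + 1) → K)) :=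
  ⟨by simp, h.map fun e => e.trans Matrix.toLinAlgEquiv'⟩

theorem IsMatrixAlgebra.idempotent_ne_zero (h : IsMatrixAlgebra K d 𝓐) {a : 𝓐}
    {E : Fin (d + 1) → 𝓐} {θ : Fin (d + 1) → K} (hθ : IsEigenvalueSequence a E θ)
    (i : Fin (d + 1)) : E i ≠ 0 := by
  obtain ⟨hV, ⟨ρ⟩⟩ := h.exists_rep
  obtain ⟨w, hw⟩ := exists_eigenbasis hV ρ hθ.1
  exact hθ.ne_zero ρ hw i

/-- The primitive idempotents determine the ordering of the eigenvalues. -/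
theorem IsMatrixAlgebra.eigenvalueSequence_unique (h : IsMatrixAlgebra K d 𝓐) {a : 𝓐}
    {E : Fin (d + 1) → 𝓐} {θ θ' : Fin (d + 1) → K} (hθ : IsEigenvalueSequence a E θ)
    (hθ' : IsEigenvalueSequence a E θ') : θ = θ' := by
  obtain ⟨hV, ⟨ρ⟩⟩ := h.exists_rep
  have key : ∀ η : Fin (d + 1) → K, IsEigenvalueSequence a E η → ∀ i, a * E i = η i • E i := by
    intro η hη i
    obtain ⟨w, hw⟩ := exists_eigenbasis hV ρ hη.1
    refine ρ.injective (LinearMap.ext fun x => ?_)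
    rw [map_mul, map_smul, Module.End.mul_apply, LinearMap.smul_apply, hη.apply_eq ρ hw, map_smul,
      hw, smul_comm]
  funext i
  have h1 := key θ hθ i
  rw [key θ' hθ' i] at h1
  exact (smul_left_injective K (h.idempotent_ne_zero hθ i) h1).symm

/-- The frames of a Leonard system in a representation. -/
theorem LeonardSystem.exists_frames (Φ : LeonardSystem K d 𝓐) {θ θs : Fin (d + 1) → K}
    (hθ : IsEigenvalueSequence Φ.A Φ.E θ) (hθs : IsEigenvalueSequence Φ.As Φ.Es θs)
    {V : Type w} [AddCommGroup V] [Module K V] (hV : Module.finrank K V = d + 1)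
    (ρ : 𝓐 ≃ₐ[K] Module.End K V) :
    ∃ (w v : Module.Basis (Fin (d + 1)) K V) (F : TriFrame d (ρ Φ.A) (ρ Φ.As))
      (G : TriFrame d (ρ Φ.As) (ρ Φ.A)),
      (∀ i x, ρ (Φ.E i) x = w.coord i x • w i) ∧ (∀ i x, ρ (Φ.Es i) x = v.coord i x • v i) ∧
      F.X = natExtend v.coord ∧ G.X = natExtend w.coord ∧
      F.e = natExtend θs ∧ G.e = natExtend θ ∧
      (∀ i : Fin (d + 1), Φ.Es i * Φ.A * Φ.Es i = F.a i • Φ.Es i) ∧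
      (∀ i : Fin (d + 1), Φ.E i * Φ.As * Φ.E i = G.a i • Φ.E i) := by
  obtain ⟨w, hw⟩ := exists_eigenbasis hV ρ hθ.1
  obtain ⟨v, hv⟩ := exists_eigenbasis hV ρ hθs.1
  refine ⟨w, v, (Φ.dualIdempotentSequence.isTridiagonalEigenbasis ρ hθs hv).frame,
    (Φ.idempotentSequence.isTridiagonalEigenbasis ρ hθ hw).frame, hθ.apply_eq ρ hw,
    hθs.apply_eq ρ hv, rfl, rfl, rfl, rfl, fun i => ?_, fun i => ?_⟩
  · rw [hθs.mul_mul_eq_smul ρ hv]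
    simp only [IsTridiagonalEigenbasis.frame, natExtend_val]
  · rw [hθ.mul_mul_eq_smul ρ hw]
    simp only [IsTridiagonalEigenbasis.frame, natExtend_val]

theorem mem_iSup_imageOf {V : Type w} [AddCommGroup V] [Module K V] [Module 𝓐 V]
    [IsScalarTower K 𝓐 V] {E : Fin (d + 1) → 𝓐} {w : Module.Basis (Fin (d + 1)) K V}
    (hE : ∀ i (x : V), E i • x = w.coord i x • w i) (s : Finset (Fin (d + 1))) (x : V) :
    x ∈ ⨆ h ∈ s, imageOf K (E h) V ↔ ∀ j, j ∉ s → w.coord j x = 0 := by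
  constructor
  · intro hx j hj
    have hle : ⨆ h ∈ s, imageOf K (E h) V ≤ LinearMap.ker (w.coord j) := by
      refine iSup₂_le fun h hs => ?_
      rintro _ ⟨y, rfl⟩
      have hne : j ≠ h := fun e => hj (e ▸ hs)
      change w.coord j (E h • y) = 0
      rw [hE, map_smul, w.coord_apply j, w.repr_self, Finsupp.single_eq_of_ne hne, smul_zero]
    exact hle hx
  · intro hx
    rw [← w.sum_repr x]
    refine Submodule.sum_mem _ fun j _ => ?_
    by_cases hj : j ∈ s
    · refine Submodule.mem_iSup_of_mem j (Submodule.mem_iSup_of_mem hj ⟨x, ?_⟩)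
      exact hE j x
    · have := hx j hj
      rw [Module.Basis.coord_apply] at this
      rw [this, zero_smul]
      exact Submodule.zero_mem _

theorem LeonardSystem.mem_splitSpace (Φ : LeonardSystem K d 𝓐) {V : Type w} [AddCommGroup V]
    [Module K V] [Module 𝓐 V] [IsScalarTower K 𝓐 V] {w v : Module.Basis (Fin (d + 1)) K V}
    (hE : ∀ i (x : V), Φ.E i • x = w.coord i x • w i)
    (hEs : ∀ i (x : V), Φ.Es i • x = v.coord i x • v i) (i : Fin (d + 1)) (x : V) :
    x ∈ Φ.splitSpace V i ↔ (∀ j, (i : ℕ) < j → natExtend v.coord j x = 0) ∧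
      ∀ j < (i : ℕ), natExtend w.coord j x = 0 := by
  rw [LeonardSystem.splitSpace, Submodule.mem_inf, mem_iSup_imageOf hEs, mem_iSup_imageOf hE]
  refine and_congr ⟨fun h j hj => ?_, fun h j hj => ?_⟩ ⟨fun h j hj => ?_, fun h j hj => ?_⟩
  · by_cases hjd : j < d + 1
    · rw [natExtend_of_lt _ hjd]
      exact h _ (by simp only [Finset.mem_Iic, Fin.le_def]; omega)
    · rw [natExtend_of_ge _ (by omega), LinearMap.zero_apply]
  · simpa using h j (by simp only [Finset.mem_Iic, Fin.le_def] at hj; omega)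
  · rw [natExtend_of_lt _ (show j < d + 1 by omega)]
    exact h _ (by simp only [Finset.mem_Ici, Fin.le_def]; omega)
  · simpa using h j (by simp only [Finset.mem_Ici, Fin.le_def] at hj; omega)


/-- The corners `Es i A Es i` are those that the scalars `θ i`, `θs i` and `φ j` prescribe. For the
eigenvalue sequences `θ, θs` of `Φ` this says that `φ` is the first split sequence of `Φ`, see
`LeonardSystem.isFirstSplitSequence_iff`. -/
def LeonardSystem.HasCorners (Φ : LeonardSystem K d 𝓐) (θ θs : Fin (d + 1) → K)
    (φ : Fin d → K) : Prop :=
  ∀ i : Fin (d + 1), Φ.Es i * Φ.A * Φ.Es i =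
    diagEntry (natExtend θ) (natExtend θs) (splitExtend φ) i • Φ.Es i

theorem LeonardSystem.HasCorners.eq_splitCoeff (h : IsMatrixAlgebra K d 𝓐)
    {Φ : LeonardSystem K d 𝓐}
    {θ θs : Fin (d + 1) → K} {φ : Fin d → K} (hφ : Φ.HasCorners θ θs φ)
    (hθs : IsEigenvalueSequence Φ.As Φ.Es θs) {V : Type w} [AddCommGroup V] [Module K V]
    {A As : Module.End K V} (F : TriFrame d A As) (G : TriFrame d As A)
    (hFe : F.e = natExtend θs) (hGe : G.e = natExtend θ)
    (hFa : ∀ i : Fin (d + 1), Φ.Es i * Φ.A * Φ.Es i = F.a i • Φ.Es i) :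
    splitExtend φ = F.splitCoeff G := by
  have key : ∀ i ≤ d, splitExtend φ i = F.splitCoeff G i := by
    refine F.splitCoeff_unique rfl fun i hi => ?_
    have h1 := hφ ⟨i, by omega⟩
    rw [hFa] at h1
    have h2 := smul_left_injective K (h.idempotent_ne_zero hθs ⟨i, by omega⟩) h1
    rw [F.a_eq G i hi.le, diagEntry, ← hFe, ← hGe] at h2
    linear_combination -h2
  funext i
  by_cases hi : i ≤ d
  · exact key i hi
  · obtain ⟨i, rfl⟩ : ∃ k, i = k + 1 := ⟨i - 1, by omega⟩
    rw [F.splitCoeff_of_lt G _ (by omega)]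
    exact natExtend_of_ge φ (by omega)

theorem LeonardSystem.hasCorners_of_splitCoeff {Φ : LeonardSystem K d 𝓐}
    {θ θs : Fin (d + 1) → K} {φ : Fin d → K} {V : Type w} [AddCommGroup V] [Module K V]
    {A As : Module.End K V} (F : TriFrame d A As) (G : TriFrame d As A)
    (hFe : F.e = natExtend θs) (hGe : G.e = natExtend θ)
    (hFa : ∀ i : Fin (d + 1), Φ.Es i * Φ.A * Φ.Es i = F.a i • Φ.Es i)
    (hφ : ∀ j : Fin d, φ j = F.splitCoeff G (j + 1)) : Φ.HasCorners θ θs φ := by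
  have hs : splitExtend φ = F.splitCoeff G := by
    funext i
    rcases i with _ | i
    · rfl
    · by_cases hi : i < d
      · exact (natExtend_of_lt φ hi).trans (hφ ⟨i, hi⟩)
      · rw [F.splitCoeff_of_lt G _ (by omega)]
        exact natExtend_of_ge φ (by omega)
  intro i
  rw [hFa, F.a_eq G i (by omega), diagEntry, hs, hFe, hGe]

/-- The first split sequence is characterized by the corners `Es i A Es i`, without reference to
modules. -/
theorem LeonardSystem.isFirstSplitSequence_iff (h : IsMatrixAlgebra K d 𝓐)
    (Φ : LeonardSystem K d 𝓐) {θ θs : Fin (d + 1) → K}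
    (hθ : IsEigenvalueSequence Φ.A Φ.E θ) (hθs : IsEigenvalueSequence Φ.As Φ.Es θs)
    (φ : Fin d → K) : Φ.IsFirstSplitSequence φ ↔ Φ.HasCorners θ θs φ := by
  constructor
  · intro hφ
    obtain ⟨S, hS⟩ := h.exists_isSimpleModule
    obtain ⟨hV, ρ, hρ⟩ := h.exists_algEquiv_end S
    obtain ⟨w, v, F, G, hE, hEs, hFX, hGX, hFe, hGe, hFa, -⟩ := Φ.exists_frames hθ hθs hV ρ
    refine LeonardSystem.hasCorners_of_splitCoeff F G hFe hGe hFa fun j => ?_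
    simp only [hρ] at hE hEs
    have hmem : F.splitVec G (j + 1) ∈ Φ.splitSpace S j.succ := by
      rw [Φ.mem_splitSpace hE hEs, ← hFX, ← hGX]
      exact ⟨fun i hi => F.X_splitVec_of_lt G _ i hi, fun i hi => F.Y_splitVec G _ i hi⟩
    have h1 := hφ θ θs hθ hθs S j _ hmem
    have h2 := F.splitCoeff_apply G j j.isLt (F.splitVec G (j + 1))
      (F.X_splitVec_of_lt G _) (F.Y_splitVec G _)
    simp only [hρ, hFe, hGe] at h2
    rw [natExtend_of_lt _ (by omega), natExtend_of_lt _ (by omega)] at h2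
    rw [mul_smul, sub_smul, sub_smul, algebraMap_smul, algebraMap_smul] at h1
    exact smul_left_injective K (F.splitVec_ne_zero G (j + 1) j.isLt) (h1.symm.trans h2)
  · intro hφ θ' θs' hθ' hθs' V _ _ _ _ _ j x hx
    obtain rfl := h.eigenvalueSequence_unique hθ hθ'
    obtain rfl := h.eigenvalueSequence_unique hθs hθs'
    obtain ⟨hV, ρ, hρ⟩ := h.exists_algEquiv_end V
    obtain ⟨w, v, F, G, hE, hEs, hFX, hGX, hFe, hGe, hFa, -⟩ := Φ.exists_frames hθ hθs hV ρ
    have hs := hφ.eq_splitCoeff h hθs F G hFe hGe hFa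
    simp only [hρ] at hE hEs
    rw [Φ.mem_splitSpace hE hEs, ← hFX, ← hGX] at hx
    have h2 := F.splitCoeff_apply G j j.isLt x hx.1 hx.2
    simp only [hρ, hFe, hGe, ← hs] at h2
    rw [natExtend_of_lt _ (by omega), natExtend_of_lt _ (by omega)] at h2
    rw [mul_smul, sub_smul, sub_smul, algebraMap_smul, algebraMap_smul]
    refine h2.trans ?_
    rw [splitExtend, natExtend_val]

theorem LeonardSystem.exists_hasCorners (h : IsMatrixAlgebra K d 𝓐)
    (Φ : LeonardSystem K d 𝓐) {θ θs : Fin (d + 1) → K}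
    (hθ : IsEigenvalueSequence Φ.A Φ.E θ) (hθs : IsEigenvalueSequence Φ.As Φ.Es θs) :
    ∃ φ : Fin d → K, Φ.HasCorners θ θs φ := by
  obtain ⟨hV, ⟨ρ⟩⟩ := h.exists_rep
  obtain ⟨w, v, F, G, -, -, -, -, hFe, hGe, hFa, -⟩ := Φ.exists_frames hθ hθs hV ρ
  exact ⟨_, LeonardSystem.hasCorners_of_splitCoeff F G hFe hGe hFa fun j => rfl⟩

end Systems

/-! ### The conditions on a parameter array -/

section natExtend

variable {M : Type*} [Zero M] {d : ℕ} (f : Fin (d + 1) → M)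

theorem natExtend_zero : natExtend f 0 = f 0 := natExtend_of_lt f (Nat.succ_pos d)

theorem natExtend_last : natExtend f d = f (Fin.last d) := natExtend_of_lt f (Nat.lt_succ_self d)

theorem natExtend_rev {i : ℕ} (hi : i ≤ d) :
    natExtend (fun j : Fin (d + 1) => f j.rev) i = natExtend f (d - i) := by
  rw [natExtend_of_lt _ (by omega), natExtend_of_lt _ (by omega)]
  congr 1
  ext
  simp only [Fin.val_rev]
  omega

end natExtend

section Systems

variable {K : Type u} [Field K] {𝓐 : Type v} [Ring 𝓐] [Algebra K 𝓐] {d : ℕ}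

/-- The corners `E i As E i`: the dual system has the same first split sequence. -/
theorem LeonardSystem.HasCorners.dual (h : IsMatrixAlgebra K d 𝓐) {Φ : LeonardSystem K d 𝓐}
    {θ θs : Fin (d + 1) → K} {φ : Fin d → K} (hφ : Φ.HasCorners θ θs φ)
    (hθ : IsEigenvalueSequence Φ.A Φ.E θ) (hθs : IsEigenvalueSequence Φ.As Φ.Es θs)
    (i : Fin (d + 1)) : Φ.E i * Φ.As * Φ.E i =
      diagEntry (natExtend θs) (natExtend θ) (splitExtend φ) i • Φ.E i := by
  obtain ⟨hV, ⟨ρ⟩⟩ := h.exists_rep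
  obtain ⟨w, v, F, G, -, -, -, -, hFe, hGe, hFa, hGa⟩ := Φ.exists_frames hθ hθs hV ρ
  rw [hGa, hφ.eq_splitCoeff h hθs F G hFe hGe hFa, G.a_eq_dual F i (by omega), diagEntry, hFe, hGe]

theorem LeonardSystem.HasCorners.ne_zero (h : IsMatrixAlgebra K d 𝓐) {Φ : LeonardSystem K d 𝓐}
    {θ θs : Fin (d + 1) → K} {φ : Fin d → K} (hφ : Φ.HasCorners θ θs φ)
    (hθ : IsEigenvalueSequence Φ.A Φ.E θ) (hθs : IsEigenvalueSequence Φ.As Φ.Es θs)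
    (j : Fin d) : φ j ≠ 0 := by
  obtain ⟨hV, ⟨ρ⟩⟩ := h.exists_rep
  obtain ⟨w, v, F, G, -, -, -, -, hFe, hGe, hFa, -⟩ := Φ.exists_frames hθ hθs hV ρ
  have h1 := F.splitCoeff_ne_zero G j j.isLt
  rw [← hφ.eq_splitCoeff h hθs F G hFe hGe hFa] at h1
  rwa [splitExtend, natExtend_val] at h1

/-- The explicit form of the first split sequence. It is the solution of a linear recurrence, and
the boundary values come from computing `Es 0 A Es 0` and `E d As E d` in two ways. -/
theorem LeonardSystem.HasCorners.splitExtend_eq (h : IsMatrixAlgebra K d 𝓐)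
    {Φ : LeonardSystem K d 𝓐} {θ θs : Fin (d + 1) → K} {φ φ' : Fin d → K}
    (hφ : Φ.HasCorners θ θs φ)
    (hφ' : Φ.secondInversion.HasCorners (fun i => θ i.rev) θs φ')
    (hθ : IsEigenvalueSequence Φ.A Φ.E θ) (hθs : IsEigenvalueSequence Φ.As Φ.Es θs)
    (hd : 1 ≤ d) (i : ℕ) (hi : i < d) :
    splitExtend φ (i + 1) = φ' ⟨0, hd⟩ *
        (∑ h ∈ Finset.range (i + 1),
          (natExtend θ h - natExtend θ (d - h)) / (natExtend θ 0 - natExtend θ d)) +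
      (natExtend θs (i + 1) - natExtend θs 0) * (natExtend θ i - natExtend θ d) := by
  obtain ⟨hV, ⟨ρ⟩⟩ := h.exists_rep
  obtain ⟨w, v, F, G, -, -, -, -, hFe, hGe, hFa, -⟩ := Φ.exists_frames hθ hθs hV ρ
  have hs := hφ.eq_splitCoeff h hθs F G hFe hGe hFa
  obtain ⟨c, b, h1, h2, h3⟩ := F.exists_recurrence G
  have hsub : ∀ {i j : ℕ}, i ≤ d → j ≤ d → i ≠ j → natExtend θ i - natExtend θ j ≠ 0 := by
    rw [← hGe]; exact G.sub_ne
  have hsubs : ∀ {i j : ℕ}, i ≤ d → j ≤ d → i ≠ j → natExtend θs i - natExtend θs j ≠ 0 := by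
    rw [← hFe]; exact F.sub_ne
  have hφ'1 : splitExtend φ' 1 = φ' ⟨0, hd⟩ := natExtend_of_lt φ' hd
  rw [hFe, hGe, ← hs] at h3
  rw [hGe] at h1
  rw [hFe] at h2
  refine eq_of_recurrence hd (sub_ne_zero.1 (hsub (Nat.zero_le d) le_rfl (by omega)))
    (fun _ => sub_ne_zero.1 (hsubs (by omega) (by omega) (by omega))) h1 h2 h3 rfl
    (natExtend_of_ge φ le_rfl) ?_ ?_ i hi
  · -- the two expressions for `Es 0 A Es 0`
    have e1 := hφ 0
    have e2 := hφ' 0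
    simp only [LeonardSystem.secondInversion] at e2
    rw [e1] at e2
    have e3 := smul_left_injective K (h.idempotent_ne_zero hθs 0) e2
    simp only [diagEntry, Fin.val_zero, natExtend_rev θ (Nat.zero_le d), Nat.sub_zero,
      zero_add, hφ'1] at e3
    simp only [splitExtend, zero_div, add_zero] at e3 ⊢
    have := hsubs (Nat.zero_le d) hd (by omega)
    field_simp at e3
    linear_combination e3
  · -- the two expressions for `E d As E d`
    have e1 := hφ.dual h hθ hθs (Fin.last d)
    have e2 := hφ'.dual h (Φ := Φ.secondInversion) hθ.rev hθs 0
    simp only [LeonardSystem.secondInversion, Fin.rev_zero] at e2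
    rw [e1] at e2
    have e3 := smul_left_injective K (h.idempotent_ne_zero hθ (Fin.last d)) e2
    simp only [diagEntry, Fin.val_zero, Fin.val_last, natExtend_rev θ (Nat.zero_le d),
      natExtend_rev θ hd, Nat.sub_zero, zero_add, hφ'1] at e3
    rw [show splitExtend φ (d + 1) = 0 from natExtend_of_ge φ le_rfl,
      show splitExtend φ' 0 = 0 from rfl] at e3
    have := hsub le_rfl (show d - 1 ≤ d by omega) (by omega)
    field_simp at e3
    linear_combination e3

theorem LeonardSystem.recurrence (h : IsMatrixAlgebra K d 𝓐)
    {Φ : LeonardSystem K d 𝓐} {θ θs : Fin (d + 1) → K}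
    (hθ : IsEigenvalueSequence Φ.A Φ.E θ) (hθs : IsEigenvalueSequence Φ.As Φ.Es θs) :
    ∃ c : K, ∀ k, k + 3 ≤ d →
      (natExtend θ k - natExtend θ (k + 3)) / (natExtend θ (k + 1) - natExtend θ (k + 2)) = c ∧
      (natExtend θs k - natExtend θs (k + 3)) / (natExtend θs (k + 1) - natExtend θs (k + 2)) =
        c := by
  obtain ⟨hV, ⟨ρ⟩⟩ := h.exists_rep
  obtain ⟨w, v, F, G, -, -, -, -, hFe, hGe, -, -⟩ := Φ.exists_frames hθ hθs hV ρ
  obtain ⟨c, b, h1, h2, -⟩ := F.exists_recurrence G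
  refine ⟨c⁻¹, fun k hk => ?_⟩
  rw [← hFe, ← hGe]
  have n1 := F.sub_ne (show k + 1 ≤ d by omega) (show k + 2 ≤ d by omega) (by omega)
  have n2 := G.sub_ne (show k + 1 ≤ d by omega) (show k + 2 ≤ d by omega) (by omega)
  have hc : c ≠ 0 := by
    rintro rfl
    exact n1 (by rw [h2 k hk, zero_mul])
  refine ⟨?_, ?_⟩
  · field_simp
    linear_combination h1 k (by omega) - h1 (k + 1) (by omega)
  · field_simp
    linear_combination -h2 k hk

theorem ScalarArray.thetaSum_eq (p : ScalarArray K d) (j : Fin d) :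
    p.thetaSum j = ∑ h ∈ Finset.range (j + 1),
      (natExtend p.theta h - natExtend p.theta (d - h)) /
        (natExtend p.theta 0 - natExtend p.theta d) := by
  rw [natExtend_zero, natExtend_last, ScalarArray.thetaSum]
  refine Finset.sum_bij (fun h _ => (h : ℕ)) ?_ ?_ ?_ ?_
  · intro h hh
    simp only [Finset.mem_Iic, Fin.le_def, Fin.val_castSucc] at hh
    simp only [Finset.mem_range]
    omega
  · intro a _ b _ hab
    exact Fin.ext hab
  · intro b hb
    have := Finset.mem_range.1 hb
    refine ⟨⟨b, by omega⟩, ?_, rfl⟩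
    simp only [Finset.mem_Iic, Fin.le_def, Fin.val_castSucc]
    omega
  · intro h _
    rw [natExtend_val, ← natExtend_rev p.theta (show (h : ℕ) ≤ d by omega), natExtend_val]

theorem LeonardSystem.secondInversion_secondInversion (Φ : LeonardSystem K d 𝓐) :
    Φ.secondInversion.secondInversion = Φ := by
  obtain ⟨⟩ := Φ
  simp [LeonardSystem.secondInversion]

namespace ScalarArray

theorem isOfSystem_iff (h : IsMatrixAlgebra K d 𝓐) (p : ScalarArray K d)
    (Φ : LeonardSystem K d 𝓐) : p.IsOfSystem Φ ↔
      IsEigenvalueSequence Φ.A Φ.E p.theta ∧ IsEigenvalueSequence Φ.As Φ.Es p.thetaStar ∧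
      Φ.HasCorners p.theta p.thetaStar p.firstSplit ∧
      Φ.secondInversion.HasCorners (fun i => p.theta i.rev) p.thetaStar p.secondSplit := by
  constructor
  · intro hp
    exact ⟨hp.1, hp.2, (Φ.isFirstSplitSequence_iff h hp.1 hp.2 _).1 hp.3,
      (Φ.secondInversion.isFirstSplitSequence_iff h hp.1.rev hp.2 _).1 hp.4⟩
  · rintro ⟨h1, h2, h3, h4⟩
    exact ⟨h1, h2, (Φ.isFirstSplitSequence_iff h h1 h2 _).2 h3,
      (Φ.secondInversion.isFirstSplitSequence_iff h h1.rev h2 _).2 h4⟩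

theorem IsOfSystem.ddown {p : ScalarArray K d} {Φ : LeonardSystem K d 𝓐} (hp : p.IsOfSystem Φ) :
    p.ddown.IsOfSystem Φ.secondInversion :=
  ⟨hp.1.rev, hp.2, hp.4, by rw [Φ.secondInversion_secondInversion]; exact hp.3⟩

theorem IsOfSystem.eq_first (h : IsMatrixAlgebra K d 𝓐) {p : ScalarArray K d}
    {Φ : LeonardSystem K d 𝓐} (hp : p.IsOfSystem Φ) (j : Fin d) :
    p.firstSplit j = p.secondSplit ⟨0, j.pos⟩ * p.thetaSum j +
      (p.thetaStar j.succ - p.thetaStar 0) * (p.theta j.castSucc - p.theta (Fin.last d)) := by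
  obtain ⟨h1, h2, h3, h4⟩ := (isOfSystem_iff h p Φ).1 hp
  have := h3.splitExtend_eq h h4 h1 h2 j.pos j j.isLt
  rwa [splitExtend, natExtend_val, ← thetaSum_eq, natExtend_last,
    natExtend_of_lt p.theta (by omega), natExtend_of_lt p.thetaStar (by omega),
    natExtend_zero] at this

theorem IsOfSystem.isParameterArray (h : IsMatrixAlgebra K d 𝓐) {p : ScalarArray K d}
    {Φ : LeonardSystem K d 𝓐} (hp : p.IsOfSystem Φ) : p.IsParameterArray := by
  obtain ⟨h1, h2, h3, h4⟩ := (isOfSystem_iff h p Φ).1 hp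
  refine ⟨h3.ne_zero h h1 h2, h4.ne_zero h (Φ := Φ.secondInversion) h1.rev h2,
    fun i j hij => h1.1.1.ne hij, fun i j hij => h2.1.1.ne hij, hp.eq_first h, fun j => ?_, ?_⟩
  · have := hp.ddown.eq_first h j
    simp only [ScalarArray.ddown, Fin.rev_last, thetaSum, Fin.rev_rev, Fin.rev_zero] at this
    rw [this, thetaSum]
    congr 2
    refine Finset.sum_congr rfl fun i _ => ?_
    rw [← neg_sub, ← neg_sub (p.theta 0), neg_div_neg_eq]
  · obtain ⟨c, hc⟩ := Φ.recurrence h h1 h2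
    refine ⟨c, fun k hk => ?_⟩
    have := hc k hk
    simpa only [natExtend_of_lt _ (show k < d + 1 by omega),
      natExtend_of_lt _ (show k + 1 < d + 1 by omega),
      natExtend_of_lt _ (show k + 2 < d + 1 by omega),
      natExtend_of_lt _ (show k + 3 < d + 1 by omega)] using this

end ScalarArray
end Systems

/-! ### The four Leonard systems of a Leonard pair -/

/-- An injective self-map of the path `0 - 1 - ⋯ - d` that preserves adjacency is the identity or
the reflection. -/
theorem eq_or_eq_rev_of_path {d : ℕ} {f : Fin (d + 1) → Fin (d + 1)} (hf : Function.Injective f)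
    (h : ∀ i j : Fin (d + 1), |(i : ℤ) - (j : ℤ)| = 1 → |(f i : ℤ) - (f j : ℤ)| ≤ 1) :
    (∀ i, f i = i) ∨ ∀ i, f i = i.rev := by
  rcases Nat.eq_zero_or_pos d with rfl | hd
  · exact Or.inl fun i => Fin.ext (by omega)
  have hstep : ∀ i (hi : i + 1 < d + 1), (f ⟨i + 1, hi⟩ : ℤ) - f ⟨i, by omega⟩ = 1 ∨
      (f ⟨i + 1, hi⟩ : ℤ) - f ⟨i, by omega⟩ = -1 := by
    intro i hi
    have h1 := abs_le.1 (h ⟨i + 1, hi⟩ ⟨i, by omega⟩ (by simp))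
    have h2 : (f ⟨i + 1, hi⟩ : ℕ) ≠ f ⟨i, by omega⟩ := fun e => by
      simpa using hf (Fin.ext e)
    omega
  have hskip : ∀ i (hi : i + 2 < d + 1), (f ⟨i + 2, hi⟩ : ℕ) ≠ f ⟨i, by omega⟩ := fun i hi e => by
    simpa using hf (Fin.ext e)
  -- the direction of the first step is kept
  have key : ∀ s : ℤ, (f ⟨1, by omega⟩ : ℤ) - f ⟨0, by omega⟩ = s → ∀ i (hi : i + 1 < d + 1),
      (f ⟨i + 1, hi⟩ : ℤ) - f ⟨i, by omega⟩ = s := by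
    intro s hs i
    induction i with
    | zero => exact fun _ => hs
    | succ i ih =>
      intro hi
      have h1 := ih (by omega)
      have h2 := hskip i hi
      have h3 := hstep (i + 1) hi
      have h4 := hstep i (by omega)
      have e : (⟨i + 1 + 1, hi⟩ : Fin (d + 1)) = ⟨i + 2, hi⟩ := rfl
      rw [e] at h3 ⊢
      omega
  rcases hstep 0 (by omega) with h1 | h1
  · left
    have h2 : ∀ i (hi : i < d + 1), (f ⟨i, hi⟩ : ℤ) = f ⟨0, by omega⟩ + i := by
      intro i
      induction i with
      | zero => simp
      | succ i ih =>
        intro hi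
        have := key 1 h1 i hi
        have := ih (by omega)
        push_cast
        omega
    have h3 := h2 d (by omega)
    have h4 := (f ⟨d, by omega⟩).isLt
    intro i
    have h5 := h2 i i.isLt
    refine Fin.ext ?_
    rw [Fin.eta] at h5
    omega
  · right
    have h2 : ∀ i (hi : i < d + 1), (f ⟨i, hi⟩ : ℤ) = f ⟨0, by omega⟩ - i := by
      intro i
      induction i with
      | zero => simp
      | succ i ih =>
        intro hi
        have := key (-1) h1 i hi
        have := ih (by omega)
        push_cast
        omega
    have h3 := h2 d (by omega)
    have h4 := (f ⟨0, by omega⟩).isLt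
    intro i
    have h5 := h2 i i.isLt
    refine Fin.ext ?_
    rw [Fin.eta] at h5
    rw [Fin.val_rev]
    omega

section Systems

variable {K : Type u} [Field K] {𝓐 : Type v} [Ring 𝓐] [Algebra K 𝓐] {d : ℕ}

theorem primitiveIdempotent_comp (a : 𝓐) (θ : Fin (d + 1) → K) (π : Equiv.Perm (Fin (d + 1)))
    (i : Fin (d + 1)) :
    primitiveIdempotent a (fun j => θ (π j)) i = primitiveIdempotent a θ (π i) := by
  unfold primitiveIdempotent Lagrange.basis
  congr 1
  exact Finset.prod_equiv π (by simp) (by simp)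

/-- Two orderings of the primitive idempotents differ by a permutation. -/
theorem IsEigenvalueSequence.exists_perm {a : 𝓐} {E E' : Fin (d + 1) → 𝓐}
    {θ θ' : Fin (d + 1) → K} (h : IsEigenvalueSequence a E θ) (h' : IsEigenvalueSequence a E' θ') :
    ∃ π : Equiv.Perm (Fin (d + 1)), ∀ i, E' i = E (π i) := by
  have h1 : ∀ i, ∃ j, θ j = θ' i := fun i => by
    have : θ' i ∈ Set.range θ := by rw [h.1.2, ← h'.1.2]; exact ⟨i, rfl⟩
    exact this
  choose π hπ using h1
  have hinj : Function.Injective π := fun i j hij => h'.1.1 (by rw [← hπ, ← hπ, hij])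
  refine ⟨Equiv.ofBijective π (Finite.injective_iff_bijective.1 hinj), fun i => ?_⟩
  rw [h'.2, h.2, ← primitiveIdempotent_comp]
  congr 1
  funext j
  exact (hπ j).symm

/-- An idempotent sequence is unique up to reversal. -/
theorem IsIdempotentSequence.eq_or_eq_rev {a b : 𝓐} {E E' : Fin (d + 1) → 𝓐} {θ : Fin (d + 1) → K}
    (hE : IsEigenvalueSequence a E θ)
    (h0 : ∀ i j : Fin (d + 1), 1 < |(i : ℤ) - (j : ℤ)| → E i * b * E j = 0)
    (h' : IsIdempotentSequence K a b E') :
    E' = E ∨ E' = fun i => E i.rev := by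
  obtain ⟨⟨θ', hθ'⟩, h2⟩ := h'
  obtain ⟨π, hπ⟩ := hE.exists_perm hθ'
  have := eq_or_eq_rev_of_path π.injective fun i j hij => by
    by_contra! hc
    refine (h2 i j).2 hij ?_
    rw [hπ, hπ]
    exact h0 _ _ hc
  refine this.imp (fun h => ?_) fun h => ?_
  · funext i; rw [hπ, h]
  · funext i; rw [hπ, h]

/-- The system `(A, As; E i, Es (d - i), i = 0..d)`. -/
def LeonardSystem.firstInversion (Φ : LeonardSystem K d 𝓐) : LeonardSystem K d 𝓐 where
  A := Φ.A
  As := Φ.As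
  E := Φ.E
  Es := fun i => Φ.Es i.rev
  multiplicityFree := Φ.multiplicityFree
  multiplicityFree_star := Φ.multiplicityFree_star
  idempotentSequence := Φ.idempotentSequence
  dualIdempotentSequence := Φ.dualIdempotentSequence.rev

theorem splitExtend_rev (φ : Fin d → K) {i : ℕ} (hi : i ≤ d + 1) :
    splitExtend (fun j => φ j.rev) i = splitExtend φ (d + 1 - i) := by
  rcases i with _ | i
  · exact (natExtend_of_ge φ le_rfl).symm
  · by_cases hd : i < d
    · rw [show d + 1 - (i + 1) = d - (i + 1) + 1 by omega, splitExtend, splitExtend,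
        natExtend_of_lt _ hd, natExtend_of_lt _ (by omega)]
      congr 1
    · rw [show d + 1 - (i + 1) = 0 by omega]
      exact natExtend_of_ge (fun j : Fin d => φ j.rev) (by omega)

theorem diagEntry_rev (θ θs : Fin (d + 1) → K) (φ : Fin d → K) {i : ℕ} (hi : i ≤ d) :
    diagEntry (natExtend fun j => θ j.rev) (natExtend fun j => θs j.rev)
        (splitExtend fun j => φ j.rev) i =
      diagEntry (natExtend θ) (natExtend θs) (splitExtend φ) (d - i) := by
  have h1 : splitExtend (fun j => φ j.rev) i /
        (natExtend (fun j => θs j.rev) i - natExtend (fun j => θs j.rev) (i - 1)) =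
      splitExtend φ (d - i + 1) / (natExtend θs (d - i) - natExtend θs (d - i + 1)) := by
    rw [splitExtend_rev φ (by omega), show d + 1 - i = d - i + 1 by omega]
    rcases i with _ | i
    · rw [show splitExtend φ (d - 0 + 1) = 0 from natExtend_of_ge φ le_rfl, zero_div, zero_div]
    · rw [natExtend_rev θs hi, natExtend_rev θs (by omega),
        show d - (i + 1 - 1) = d - (i + 1) + 1 by omega]
  have h2 : splitExtend (fun j => φ j.rev) (i + 1) /
        (natExtend (fun j => θs j.rev) i - natExtend (fun j => θs j.rev) (i + 1)) =
      splitExtend φ (d - i) / (natExtend θs (d - i) - natExtend θs (d - i - 1)) := by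
    rw [splitExtend_rev φ (by omega), show d + 1 - (i + 1) = d - i by omega]
    by_cases hd : i < d
    · rw [natExtend_rev θs hi, natExtend_rev θs hd, Nat.sub_sub]
    · rw [show d - i = 0 by omega, show splitExtend φ 0 = 0 from rfl, zero_div, zero_div]
  rw [diagEntry, diagEntry, h1, h2, natExtend_rev θ hi]
  ring

theorem LeonardSystem.HasCorners.rev {Φ Ψ : LeonardSystem K d 𝓐} {θ θs : Fin (d + 1) → K}
    {φ : Fin d → K} (h : Φ.HasCorners θ θs φ) (hA : Ψ.A = Φ.A) (hEs : ∀ i, Ψ.Es i = Φ.Es i.rev) :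
    Ψ.HasCorners (fun i => θ i.rev) (fun i => θs i.rev) (fun j => φ j.rev) := by
  intro i
  have := h i.rev
  rw [hA, hEs, diagEntry_rev θ θs φ (show (i : ℕ) ≤ d by omega), this, Fin.val_rev,
    Nat.add_sub_add_right]

namespace ScalarArray

theorem IsOfSystem.down (h : IsMatrixAlgebra K d 𝓐) {p : ScalarArray K d}
    {Φ : LeonardSystem K d 𝓐} (hp : p.IsOfSystem Φ) : p.down.IsOfSystem Φ.firstInversion := by
  rw [isOfSystem_iff h] at hp ⊢
  obtain ⟨h1, h2, h3, h4⟩ := hp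
  refine ⟨h1, h2.rev, ?_, ?_⟩
  · have := h4.rev (Ψ := Φ.firstInversion) rfl fun _ => rfl
    simp only [Fin.rev_rev] at this
    exact this
  · exact h3.rev rfl fun _ => rfl

theorem exists_isOfSystem (h : IsMatrixAlgebra K d 𝓐) (Φ : LeonardSystem K d 𝓐) :
    ∃ p : ScalarArray K d, p.IsOfSystem Φ := by
  obtain ⟨θ, hθ⟩ := Φ.idempotentSequence.1
  obtain ⟨θs, hθs⟩ := Φ.dualIdempotentSequence.1
  obtain ⟨φ, hφ⟩ := Φ.exists_hasCorners h hθ hθs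
  obtain ⟨φ', hφ'⟩ := Φ.secondInversion.exists_hasCorners h hθ.rev hθs
  exact ⟨⟨θ, θs, φ, φ'⟩, (isOfSystem_iff h _ Φ).2 ⟨hθ, hθs, hφ, hφ'⟩⟩

theorem IsOfSystem.unique (h : IsMatrixAlgebra K d 𝓐) {p q : ScalarArray K d}
    {Φ : LeonardSystem K d 𝓐} (hp : p.IsOfSystem Φ) (hq : q.IsOfSystem Φ) : p = q := by
  have hsplit : ∀ (Ψ : LeonardSystem K d 𝓐) (θ θs : Fin (d + 1) → K) (φ φ' : Fin d → K),
      IsEigenvalueSequence Ψ.A Ψ.E θ → IsEigenvalueSequence Ψ.As Ψ.Es θs →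
      Ψ.HasCorners θ θs φ → Ψ.HasCorners θ θs φ' → φ = φ' := by
    intro Ψ θ θs φ φ' hθ hθs hφ hφ'
    obtain ⟨hV, ⟨ρ⟩⟩ := h.exists_rep
    obtain ⟨w, v, F, G, -, -, -, -, hFe, hGe, hFa, -⟩ := Ψ.exists_frames hθ hθs hV ρ
    have := (hφ.eq_splitCoeff h hθs F G hFe hGe hFa).trans
      (hφ'.eq_splitCoeff h hθs F G hFe hGe hFa).symm
    funext j
    simpa [splitExtend] using congrFun this (j + 1)
  obtain ⟨θ, θs, φ, φ'⟩ := p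
  obtain ⟨η, ηs, ψ, ψ'⟩ := q
  rw [isOfSystem_iff h] at hp hq
  obtain ⟨h1, h2, h3, h4⟩ := hp
  obtain ⟨k1, k2, k3, k4⟩ := hq
  simp only at h1 h2 h3 h4 k1 k2 k3 k4
  obtain rfl := h.eigenvalueSequence_unique h1 k1
  obtain rfl := h.eigenvalueSequence_unique h2 k2
  obtain rfl := hsplit Φ θ θs φ ψ h1 h2 h3 k3
  obtain rfl := hsplit Φ.secondInversion _ θs φ' ψ' h1.rev h2 h4 k4
  rfl

end ScalarArray

/-- A Leonard pair has the four parameter arrays `p`, `p.down`, `p.ddown` and `p.down.ddown`. -/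
theorem parameterArrays_eq (h : IsMatrixAlgebra K d 𝓐) {A As : 𝓐} {p : ScalarArray K d}
    (hp : p ∈ parameterArrays K d A As) :
    parameterArrays K d A As = {p, p.down, p.ddown, p.down.ddown} := by
  obtain ⟨Φ, rfl, rfl, hp⟩ := hp
  ext q
  constructor
  · rintro ⟨Ψ, hA, hAs, hq⟩
    have hE := Φ.idempotentSequence
    have hEs := Φ.dualIdempotentSequence
    have h1 := IsIdempotentSequence.eq_or_eq_rev hp.1 (fun i j hij => (hE.2 i j).1 hij)
      (hA ▸ hAs ▸ Ψ.idempotentSequence)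
    have h2 := IsIdempotentSequence.eq_or_eq_rev hp.2 (fun i j hij => (hEs.2 i j).1 hij)
      (hA ▸ hAs ▸ Ψ.dualIdempotentSequence)
    obtain ⟨B, Bs, E, Es, _, _, _, _⟩ := Ψ
    simp only at hA hAs h1 h2
    subst hA hAs
    rcases h1 with rfl | rfl <;> rcases h2 with rfl | rfl
    · exact Or.inl (hq.unique h hp)
    · exact Or.inr (Or.inl (hq.unique h (Φ := Φ.firstInversion) (hp.down h)))
    · exact Or.inr (Or.inr (Or.inl (hq.unique h (Φ := Φ.secondInversion) hp.ddown)))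
    · exact Or.inr (Or.inr (Or.inr (hq.unique h (Φ := Φ.firstInversion.secondInversion)
        (hp.down h).ddown)))
  · rintro (rfl | rfl | rfl | rfl)
    · exact ⟨Φ, rfl, rfl, hp⟩
    · exact ⟨Φ.firstInversion, rfl, rfl, hp.down h⟩
    · exact ⟨Φ.secondInversion, rfl, rfl, hp.ddown⟩
    · exact ⟨Φ.firstInversion.secondInversion, rfl, rfl, (hp.down h).ddown⟩

end Systems

/-! ### The matrix `p^T` and transport along isomorphisms -/

section Matrix

variable {K : Type u} [Field K] {𝓐 : Type v} [Ring 𝓐] [Algebra K 𝓐] {d : ℕ}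

theorem prod_Iio_sub (f : Fin (d + 1) → K) (i j : Fin (d + 1)) :
    ∏ h ∈ Finset.Iio i, (f j - f h) =
      ∏ h ∈ Finset.range i, (natExtend f j - natExtend f h) := by
  refine Finset.prod_bij (fun h _ => (h : ℕ)) ?_ ?_ ?_ ?_
  · intro h hh
    simpa only [Finset.mem_range, Finset.mem_Iio, Fin.lt_def] using hh
  · intro a _ b _ hab
    exact Fin.ext hab
  · intro b hb
    have := Finset.mem_range.1 hb
    exact ⟨⟨b, by omega⟩, by simpa only [Finset.mem_Iio, Fin.lt_def] using this, rfl⟩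
  · intro h _
    rw [natExtend_val, natExtend_val]

theorem prod_Iio_rev (f : Fin (d + 1) → K) (i : Fin (d + 1)) :
    ∏ h ∈ Finset.Iio i.rev, f h.rev = ∏ h ∈ Finset.Ioi i, f h :=
  Finset.prod_equiv Fin.revPerm (fun j => by simp [Fin.lt_rev_iff]) fun j _ => by simp

section Normalized

variable {V : Type w} [AddCommGroup V] [Module K V] {v : Module.Basis (Fin (d + 1)) K V}

/-- The entries of `A` above the diagonal, in an eigenbasis of `As` whose sum lies in `E 0 V`. -/
theorem ScalarArray.IsOfSystem.coord_super (h : IsMatrixAlgebra K d 𝓐)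
    (hV : Module.finrank K V = d + 1) (ρ : 𝓐 ≃ₐ[K] Module.End K V) {p : ScalarArray K d}
    {Φ : LeonardSystem K d 𝓐}
    (hp : p.IsOfSystem Φ) (hv : ∀ i, ρ Φ.As (v i) = p.thetaStar i • v i)
    (hsum : ρ Φ.A (∑ i, v i) = p.theta 0 • ∑ i, v i) (i j : Fin (d + 1))
    (hij : (i : ℕ) + 1 = j) :
    v.coord i (ρ Φ.A (v j)) = p.firstSplit ⟨i, by omega⟩ *
      ((∏ h ∈ Finset.Iio i, (p.thetaStar i - p.thetaStar h)) /
          ∏ h ∈ Finset.Iio j, (p.thetaStar j - p.thetaStar h)) := by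
  obtain ⟨hθ, hθs, hφ, -⟩ := (ScalarArray.isOfSystem_iff h p Φ).1 hp
  obtain ⟨w, hw⟩ := exists_eigenbasis hV ρ hθ.1
  let F := (Φ.dualIdempotentSequence.isTridiagonalEigenbasis ρ hθs hv).frame
  let G := (Φ.idempotentSequence.isTridiagonalEigenbasis ρ hθ hw).frame
  -- the vector `w 0` is a multiple of the sum of the basis `v`
  obtain ⟨r, hr⟩ : ∃ r : K, ∑ i, v i = r • w 0 := by
    refine ⟨w.coord 0 (∑ i, v i), ?_⟩
    refine w.repr.injective (Finsupp.ext fun k => ?_)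
    rw [map_smul, w.repr_self, Finsupp.smul_apply, Finsupp.single_apply]
    split_ifs with hk
    · subst hk; simp
    · have h1 := (Φ.idempotentSequence.isTridiagonalEigenbasis ρ hθ hw).frame.X_diag k (∑ i, v i)
      simp only [IsTridiagonalEigenbasis.frame, natExtend_val] at h1
      rw [hsum, map_smul, smul_eq_mul] at h1
      have h2 : (p.theta 0 - p.theta k) * w.coord k (∑ i, v i) = 0 := by linear_combination h1
      have h3 := (mul_eq_zero.1 h2).resolve_left (sub_ne_zero.2 (hθ.1.1.ne hk))
      simpa using h3
  have hX : ∀ k : Fin (d + 1), r * F.X k G.v = 1 := fun k => by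
    change r * natExtend v.coord k (w 0) = 1
    rw [natExtend_val, ← smul_eq_mul, ← map_smul, ← hr]
    simp [Finsupp.single_apply]
  have hs := hφ.eq_splitCoeff h hθs F G rfl rfl fun k => by
    rw [hθs.mul_mul_eq_smul ρ hv]
    simp only [F, IsTridiagonalEigenbasis.frame, natExtend_val]
  have hb := F.b_dual G i (by omega)
  have hFb : F.b i = v.coord i (ρ Φ.A (v j)) := by
    simp only [F, IsTridiagonalEigenbasis.frame, hij, natExtend_val]
  rw [hFb, F.splitCoeff_dual G, ← hs, hij] at hb
  have hφi : splitExtend p.firstSplit j = p.firstSplit ⟨i, by omega⟩ := by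
    rw [← hij]
    exact natExtend_of_lt _ _
  have hne := F.prod_e_ne (le_refl (j : ℕ)) (by omega)
  have hXi := hX i
  have hXj := hX j
  rw [prod_Iio_sub, prod_Iio_sub]
  change v.coord i (ρ Φ.A (v j)) = _ * ((∏ h ∈ Finset.range i, (F.e i - F.e h)) /
    ∏ h ∈ Finset.range j, (F.e j - F.e h))
  rw [hφi] at hb
  field_simp
  linear_combination r * hb - v.coord i (ρ Φ.A (v j)) *
    (∏ h ∈ Finset.range j, (F.e j - F.e h)) * hXj +
    p.firstSplit ⟨i, by omega⟩ * (∏ h ∈ Finset.range i, (F.e i - F.e h)) * hXi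

theorem ScalarArray.tMatrix_diag (p : ScalarArray K d) (i : Fin (d + 1)) :
    p.tMatrix i i =
      diagEntry (natExtend p.theta) (natExtend p.thetaStar) (splitExtend p.firstSplit) i := by
  simp only [ScalarArray.tMatrix, Matrix.of_apply, if_true]
  rw [diagEntry, natExtend_val, natExtend_val]
  congr 1
  · congr 1
    obtain ⟨i, hi⟩ := i
    rcases i with _ | i
    · simp [splitExtend]
    · rw [dif_pos (Nat.succ_pos i), natExtend_of_lt _ (by simp only; omega), splitExtend,
        natExtend_of_lt _ (by omega)]
      rfl
  · split_ifs with hi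
    · rw [natExtend_of_lt _ (show (i : ℕ) + 1 < d + 1 by omega), splitExtend, natExtend_of_lt _ hi]
    · rw [splitExtend, natExtend_of_ge _ (by omega), zero_div]

/-- In an eigenbasis of `As` whose sum lies in `E 0 V`, the element `A` is represented by the matrix
`p^T`. The entries below the diagonal are those above the diagonal for the inverted system. -/
theorem ScalarArray.IsOfSystem.toMatrix_eq_tMatrix (h : IsMatrixAlgebra K d 𝓐)
    (hV : Module.finrank K V = d + 1) (ρ : 𝓐 ≃ₐ[K] Module.End K V) {p : ScalarArray K d}
    {Φ : LeonardSystem K d 𝓐}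
    (hp : p.IsOfSystem Φ) (hv : ∀ i, ρ Φ.As (v i) = p.thetaStar i • v i)
    (hsum : ρ Φ.A (∑ i, v i) = p.theta 0 • ∑ i, v i) :
    LinearMap.toMatrixAlgEquiv v (ρ Φ.A) = p.tMatrix := by
  obtain ⟨hθ, hθs, hφ, -⟩ := (ScalarArray.isOfSystem_iff h p Φ).1 hp
  ext i j
  rw [LinearMap.toMatrixAlgEquiv_apply, ← v.coord_apply]
  rcases eq_or_ne i j with rfl | hij
  · have e1 := hθs.mul_mul_eq_smul ρ hv Φ.A i
    rw [hφ i] at e1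
    rw [p.tMatrix_diag]
    exact (smul_left_injective K (h.idempotent_ne_zero hθs i) e1).symm
  simp only [ScalarArray.tMatrix, Matrix.of_apply, if_neg hij]
  by_cases h1 : (i : ℕ) + 1 = j
  · rw [dif_pos h1]
    exact hp.coord_super h hV ρ hv hsum i j h1
  rw [dif_neg h1]
  by_cases h2 : (j : ℕ) + 1 = i
  · rw [dif_pos h2]
    have hv' : ∀ k, ρ Φ.firstInversion.As (v.reindex Fin.revPerm k) =
        p.down.thetaStar k • v.reindex Fin.revPerm k := fun k => by
      rw [Module.Basis.reindex_apply]
      exact hv k.rev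
    have hsum' : ∑ k, v.reindex Fin.revPerm k = ∑ k, v k := by
      simp only [Module.Basis.reindex_apply]
      exact Equiv.sum_comp Fin.revPerm.symm v
    have e1 := (hp.down h).coord_super h hV ρ hv' (by rw [hsum']; exact hsum) i.rev j.rev (by
      simp only [Fin.val_rev]; omega)
    simp only [ScalarArray.down] at e1
    rw [prod_Iio_rev (fun k => p.thetaStar i.rev.rev - p.thetaStar k),
      prod_Iio_rev (fun k => p.thetaStar j.rev.rev - p.thetaStar k), Fin.rev_rev, Fin.rev_rev] at e1
    have e2 : (⟨(i.rev : ℕ), by simp only [Fin.val_rev]; omega⟩ : Fin d).rev =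
        ⟨j, by omega⟩ := by
      ext
      simp only [Fin.val_rev]
      omega
    rw [e2] at e1
    rw [← e1]
    simp [LeonardSystem.firstInversion]
  · rw [dif_neg h2]
    refine (Φ.dualIdempotentSequence.isTridiagonalEigenbasis ρ hθs hv).eq_zero i j ?_
    have : (i : ℕ) ≠ j := fun e => hij (Fin.ext e)
    rw [lt_abs]
    omega

theorem ScalarArray.dMatrix_eq_toMatrix (ρ : 𝓐 ≃ₐ[K] Module.End K V) {p : ScalarArray K d}
    {As : 𝓐} (hv : ∀ i, ρ As (v i) = p.thetaStar i • v i) :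
    LinearMap.toMatrixAlgEquiv v (ρ As) = p.dMatrix := by
  ext i j
  rw [LinearMap.toMatrixAlgEquiv_apply, hv, map_smul, v.repr_self, ScalarArray.dMatrix,
    Matrix.diagonal_apply, Finsupp.smul_apply, Finsupp.single_apply]
  by_cases hij : i = j
  · subst hij; simp
  · simp [hij, Ne.symm hij]

/-- The eigenbasis of `As` formed by the components of a vector in `E 0 V`. -/
theorem LeonardSystem.exists_normalized_basis (Φ : LeonardSystem K d 𝓐) {θ θs : Fin (d + 1) → K}
    (hθ : IsEigenvalueSequence Φ.A Φ.E θ) (hθs : IsEigenvalueSequence Φ.As Φ.Es θs)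
    (hV : Module.finrank K V = d + 1) (ρ : 𝓐 ≃ₐ[K] Module.End K V) :
    ∃ v : Module.Basis (Fin (d + 1)) K V, (∀ i, ρ Φ.As (v i) = θs i • v i) ∧
      ρ Φ.A (∑ i, v i) = θ 0 • ∑ i, v i := by
  obtain ⟨w, hw⟩ := exists_eigenbasis hV ρ hθ.1
  obtain ⟨v, hv⟩ := exists_eigenbasis hV ρ hθs.1
  let F := (Φ.dualIdempotentSequence.isTridiagonalEigenbasis ρ hθs hv).frame
  let G := (Φ.idempotentSequence.isTridiagonalEigenbasis ρ hθ hw).frame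
  have hne : ∀ i, v.coord i (w 0) ≠ 0 := fun i => by
    have : natExtend v.coord i (w 0) ≠ 0 := F.X_v_ne_zero G i (by omega)
    rwa [natExtend_val] at this
  refine ⟨v.isUnitSMul (w := fun i => v.coord i (w 0)) fun i => (hne i).isUnit, fun i => ?_, ?_⟩
  · rw [Module.Basis.isUnitSMul_apply, map_smul, hv, smul_comm]
  · have : ∑ i, v.isUnitSMul (w := fun i => v.coord i (w 0)) (fun i => (hne i).isUnit) i = w 0 := by
      simp only [Module.Basis.isUnitSMul_apply]
      exact v.sum_repr (w 0)
    rw [this, hw]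

end Normalized
end Matrix

section Transport

variable {K : Type u} [Field K] {𝓐 : Type v} [Ring 𝓐] [Algebra K 𝓐] {𝓑 : Type w} [Ring 𝓑]
  [Algebra K 𝓑] {d : ℕ} (σ : 𝓐 ≃ₐ[K] 𝓑)

theorem IsMultiplicityFree.map {a : 𝓐} (h : IsMultiplicityFree K d a) :
    IsMultiplicityFree K d (σ a) := by
  rw [IsMultiplicityFree, AlgEquiv.spectrum_eq]
  exact h

theorem IsEigenvalueSequence.map {a : 𝓐} {E : Fin (d + 1) → 𝓐} {θ : Fin (d + 1) → K}
    (h : IsEigenvalueSequence a E θ) : IsEigenvalueSequence (σ a) (fun i => σ (E i)) θ := by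
  refine ⟨⟨h.1.1, by rw [AlgEquiv.spectrum_eq]; exact h.1.2⟩, fun i => ?_⟩
  change σ (E i) = _
  rw [h.2, primitiveIdempotent, primitiveIdempotent, Polynomial.aeval_algHom_apply]

theorem IsIdempotentSequence.map {a b : 𝓐} {E : Fin (d + 1) → 𝓐}
    (h : IsIdempotentSequence K a b E) :
    IsIdempotentSequence K (σ a) (σ b) (fun i => σ (E i)) := by
  obtain ⟨⟨θ, hθ⟩, h2⟩ := h
  refine ⟨⟨θ, hθ.map σ⟩, fun i j => ?_⟩
  rw [← map_mul, ← map_mul, Ne, map_eq_zero_iff σ σ.injective]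
  exact h2 i j

/-- The image of a Leonard system under an isomorphism. -/
def LeonardSystem.map (Φ : LeonardSystem K d 𝓐) : LeonardSystem K d 𝓑 where
  A := σ Φ.A
  As := σ Φ.As
  E := fun i => σ (Φ.E i)
  Es := fun i => σ (Φ.Es i)
  multiplicityFree := Φ.multiplicityFree.map σ
  multiplicityFree_star := Φ.multiplicityFree_star.map σ
  idempotentSequence := Φ.idempotentSequence.map σ
  dualIdempotentSequence := Φ.dualIdempotentSequence.map σ

theorem LeonardSystem.HasCorners.map {Φ : LeonardSystem K d 𝓐} {θ θs : Fin (d + 1) → K}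
    {φ : Fin d → K} (h : Φ.HasCorners θ θs φ) : (Φ.map σ).HasCorners θ θs φ := fun i => by
  change σ (Φ.Es i) * σ Φ.A * σ (Φ.Es i) = _ • σ (Φ.Es i)
  rw [← map_mul, ← map_mul, h i, map_smul]

theorem IsMatrixAlgebra.map (σ : 𝓐 ≃ₐ[K] 𝓑) (h : IsMatrixAlgebra K d 𝓐) :
    IsMatrixAlgebra K d 𝓑 :=
  Nonempty.map (fun e => σ.symm.trans e) h

theorem ScalarArray.IsOfSystem.map (h : IsMatrixAlgebra K d 𝓐) {p : ScalarArray K d}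
    {Φ : LeonardSystem K d 𝓐} (hp : p.IsOfSystem Φ) : p.IsOfSystem (Φ.map σ) := by
  rw [ScalarArray.isOfSystem_iff h] at hp
  rw [ScalarArray.isOfSystem_iff (h.map σ)]
  exact ⟨hp.1.map σ, hp.2.1.map σ, hp.2.2.1.map σ, hp.2.2.2.map σ⟩

theorem parameterArrays_map (h : IsMatrixAlgebra K d 𝓐) {A As : 𝓐} {p : ScalarArray K d}
    (hp : p ∈ parameterArrays K d A As) : p ∈ parameterArrays K d (σ A) (σ As) := by
  obtain ⟨Φ, rfl, rfl, hp⟩ := hp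
  exact ⟨Φ.map σ, rfl, rfl, hp.map σ h⟩

theorem IsLeonardPair.map {A As : 𝓐} (h : IsLeonardPair K d A As) :
    IsLeonardPair K d (σ A) (σ As) where
  multiplicityFree := h.1.map σ
  multiplicityFree_star := h.2.map σ
  exists_idempotentSequence := h.3.imp' (fun E i => σ (E i)) fun _ hE => hE.map σ
  exists_dualIdempotentSequence := h.4.imp' (fun E i => σ (E i)) fun _ hE => hE.map σ

end Transport

/-! ### TD-D canonical forms -/

theorem ScalarArray.down_of_diameter_zero {K : Type u} (p : ScalarArray K 0) : p.down = p := by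
  refine ScalarArray.ext rfl (funext fun i => ?_) (funext fun j => j.elim0)
    (funext fun j => j.elim0)
  exact congrArg p.thetaStar (Fin.ext (by omega))

theorem ScalarArray.ddown_of_diameter_zero {K : Type u} (p : ScalarArray K 0) : p.ddown = p := by
  refine ScalarArray.ext (funext fun i => ?_) rfl (funext fun j => j.elim0)
    (funext fun j => j.elim0)
  exact congrArg p.theta (Fin.ext (by omega))

section Canonical

variable {K : Type u} [Field K] {𝓐 : Type v} [Ring 𝓐] [Algebra K 𝓐] {d : ℕ}

theorem isMatrixAlgebra_matrix :
    IsMatrixAlgebra K d (Matrix (Fin (d + 1)) (Fin (d + 1)) K) :=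
  ⟨AlgEquiv.refl⟩

theorem isParameterArray_of_mem (h : IsMatrixAlgebra K d 𝓐) {A As : 𝓐} {p : ScalarArray K d}
    (hp : p ∈ parameterArrays K d A As) : p.IsParameterArray := by
  obtain ⟨_, _, _, hpΦ⟩ := hp
  exact hpΦ.isParameterArray h

theorem ScalarArray.isTridiagonal_tMatrix (p : ScalarArray K d) : IsTridiagonal p.tMatrix := by
  intro i j hij
  by_contra! hc
  apply hij
  simp only [ScalarArray.tMatrix, Matrix.of_apply]
  rw [if_neg hc.1, dif_neg hc.2.1, dif_neg hc.2.2]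

/-- The pair `p^T, p^D` is isomorphic to the Leonard pair with parameter array `p`, and `p^T` has
constant row sum `θ 0`. -/
theorem exists_algEquiv_tMatrix (h : IsMatrixAlgebra K d 𝓐) {A As : 𝓐} {p : ScalarArray K d}
    (hp : p ∈ parameterArrays K d A As) :
    (∃ σ : 𝓐 ≃ₐ[K] Matrix (Fin (d + 1)) (Fin (d + 1)) K, σ A = p.tMatrix ∧ σ As = p.dMatrix) ∧
      HasConstantRowSum p.tMatrix (p.theta 0) := by
  obtain ⟨Φ, rfl, rfl, hp⟩ := hp
  obtain ⟨hV, ⟨ρ⟩⟩ := h.exists_rep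
  obtain ⟨v, hv, hsum⟩ := Φ.exists_normalized_basis hp.1 hp.2 hV ρ
  have hT := hp.toMatrix_eq_tMatrix h hV ρ hv hsum
  refine ⟨⟨ρ.trans (LinearMap.toMatrixAlgEquiv v), hT, ScalarArray.dMatrix_eq_toMatrix ρ hv⟩,
    fun i => ?_⟩
  rw [← hT]
  have h1 := congrArg (v.coord i) hsum
  simp only [map_sum, map_smul] at h1
  simp only [LinearMap.toMatrixAlgEquiv_apply]
  simp only [Module.Basis.coord_apply] at h1
  rw [h1]
  simp [Finsupp.single_apply]

theorem tMatrix_mem_tddCanonicalForms (h : IsMatrixAlgebra K d 𝓐) {A As : 𝓐}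
    (hA : IsLeonardPair K d A As) {p : ScalarArray K d}
    (hp : p ∈ parameterArrays K d A As) :
    (p.tMatrix, p.dMatrix) ∈ tddCanonicalForms K d A As := by
  obtain ⟨⟨σ, h1, h2⟩, h3⟩ := exists_algEquiv_tMatrix h hp
  refine ⟨⟨?_, p.isTridiagonal_tMatrix, Matrix.isDiag_diagonal _, p.theta, ?_, Or.inl h3⟩,
    σ, h1, h2⟩
  · have := hA.map σ
    rwa [h1, h2] at this
  · have := parameterArrays_map σ h hp
    rw [h1, h2] at this
    obtain ⟨Φ, hΦ, hΦs, hpΦ⟩ := this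
    exact ⟨Φ, hΦ, hΦs, hpΦ.1⟩

/-- A Leonard pair in TD-D canonical form is recovered from its designated parameter array. -/
theorem IsDesignatedParameterArray.eq {B Bs : Matrix (Fin (d + 1)) (Fin (d + 1)) K}
    {p : ScalarArray K d} (hp : IsDesignatedParameterArray B Bs p) (hBs : Bs.IsDiag) :
    p ∈ parameterArrays K d B Bs ∧ (p.tMatrix, p.dMatrix) = (B, Bs) := by
  obtain ⟨Φ, rfl, rfl, hp, hsum, hdiag⟩ := hp
  refine ⟨⟨Φ, rfl, rfl, hp⟩, ?_⟩
  have hD : p.dMatrix = Φ.As := by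
    rw [ScalarArray.dMatrix, funext hdiag]
    exact hBs.diagonal_diag
  refine Prod.ext ?_ hD
  have hT := hp.toMatrix_eq_tMatrix isMatrixAlgebra_matrix (by simp) Matrix.toLinAlgEquiv'
    (v := Pi.basisFun K (Fin (d + 1))) (fun i => ?_) ?_
  · rw [← hT]
    ext i j
    simp [LinearMap.toMatrixAlgEquiv_apply]
  · rw [← hD, ScalarArray.dMatrix, Matrix.toLinAlgEquiv'_apply, Pi.basisFun_apply,
      Matrix.diagonal_mulVec_single, mul_one]
    ext k
    simp [Pi.single_apply]
  · have h1 : ∑ i, Pi.basisFun K (Fin (d + 1)) i = 1 := by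
      ext k
      simp [Finset.sum_apply, Pi.single_apply]
    rw [h1, Matrix.toLinAlgEquiv'_apply]
    ext k
    simpa [Matrix.mulVec, dotProduct] using hsum k

/-- A Leonard pair in TD-D canonical form has a designated parameter array. -/
theorem IsInTDDForm.exists_designated {B Bs : Matrix (Fin (d + 1)) (Fin (d + 1)) K}
    (h : IsInTDDForm B Bs) : ∃ p : ScalarArray K d, IsDesignatedParameterArray B Bs p := by
  obtain ⟨hLP, htri, hdiag, θ, ⟨Φ, rfl, rfl, hθ⟩, hrow⟩ := h
  obtain ⟨θs, hθs⟩ := Φ.dualIdempotentSequence.1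
  -- the diagonal entries of `Bs` are an ordering of its eigenvalues
  set η : Fin (d + 1) → K := fun i => Φ.As i i with hη
  have hAs : Matrix.diagonal η = Φ.As := hdiag.diagonal_diag
  have hrange : Set.range η = spectrum K Φ.As := by rw [← hAs, spectrum_diagonal]
  have hinj : Function.Injective η := by
    have h1 : (Set.range η).ncard = d + 1 := by rw [hrange]; exact Φ.multiplicityFree_star
    rw [← Set.injOn_univ, ← Set.ncard_image_iff, Set.image_univ, h1]
    simp [Set.ncard_univ]
  have hE : IsEigenvalueSequence Φ.As (primitiveIdempotent Φ.As η) η :=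
    ⟨⟨hinj, hrange⟩, fun _ => rfl⟩
  have hv : ∀ i, Matrix.toLinAlgEquiv' Φ.As (Pi.basisFun K (Fin (d + 1)) i) =
      η i • Pi.basisFun K (Fin (d + 1)) i := fun i => by
    rw [← hAs, Matrix.toLinAlgEquiv'_apply, Pi.basisFun_apply, Matrix.diagonal_mulVec_single,
      mul_one]
    ext k
    simp [Pi.single_apply]
  have h0 : ∀ i j : Fin (d + 1), 1 < |(i : ℤ) - (j : ℤ)| →
      primitiveIdempotent Φ.As η i * Φ.A * primitiveIdempotent Φ.As η j = 0 := by
    intro i j hij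
    rw [hE.mul_mul_eq_zero_iff Matrix.toLinAlgEquiv' hv]
    have h1 : Φ.A i j = 0 := by
      by_contra hne
      rw [lt_abs] at hij
      rcases htri i j hne with rfl | h2 | h2 <;> omega
    simpa using h1
  have hEs : IsIdempotentSequence K Φ.As Φ.A (primitiveIdempotent Φ.As η) := by
    rcases IsIdempotentSequence.eq_or_eq_rev hE h0 Φ.dualIdempotentSequence with h1 | h1
    · rw [← h1]
      exact Φ.dualIdempotentSequence
    · have h2 := Φ.dualIdempotentSequence.rev
      rw [h1] at h2
      simpa only [Fin.rev_rev] using h2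
  have key : ∀ (E : Fin (d + 1) → Matrix (Fin (d + 1)) (Fin (d + 1)) K) (θ : Fin (d + 1) → K),
      IsIdempotentSequence K Φ.A Φ.As E → IsEigenvalueSequence Φ.A E θ →
      HasConstantRowSum Φ.A (θ 0) →
        ∃ p : ScalarArray K d, IsDesignatedParameterArray Φ.A Φ.As p := by
    intro E θ hE' hθ hrow
    let Ψ : LeonardSystem K d (Matrix (Fin (d + 1)) (Fin (d + 1)) K) :=
      ⟨Φ.A, Φ.As, E, _, Φ.multiplicityFree, Φ.multiplicityFree_star, hE', hEs⟩
    obtain ⟨p, hp⟩ := ScalarArray.exists_isOfSystem isMatrixAlgebra_matrix Ψ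
    obtain rfl := isMatrixAlgebra_matrix.eigenvalueSequence_unique hp.1 hθ
    have h2 := isMatrixAlgebra_matrix.eigenvalueSequence_unique hp.2 hE
    exact ⟨p, Ψ, rfl, rfl, hp, hrow, fun i => by rw [h2]⟩
  rcases hrow with hrow | hrow
  · exact key _ _ Φ.idempotentSequence hθ hrow
  · exact key _ _ Φ.idempotentSequence.rev hθ.rev (by rwa [Fin.rev_zero])

theorem bijOn_tMatrix (h : IsMatrixAlgebra K d 𝓐) {A As : 𝓐} (hA : IsLeonardPair K d A As) :
    Set.BijOn (fun p : ScalarArray K d => (p.tMatrix, p.dMatrix))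
      (parameterArrays K d A As) (tddCanonicalForms K d A As) := by
  refine ⟨fun p hp => tMatrix_mem_tddCanonicalForms h hA hp, fun p hp q hq hpq => ?_, ?_⟩
  · rw [Prod.mk.injEq] at hpq
    have hs : q.thetaStar = p.thetaStar := (Matrix.diagonal_injective hpq.2).symm
    have h0 : q.theta 0 = p.theta 0 := by
      have h1 := (exists_algEquiv_tMatrix h hp).2 0
      have h2 := (exists_algEquiv_tMatrix h hq).2 0
      rw [← h1, ← h2, hpq.1]
    have hpa := isParameterArray_of_mem h hp
    rw [parameterArrays_eq h hp] at hq
    rcases Nat.eq_zero_or_pos d with rfl | hd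
    · rw [p.down_of_diameter_zero, p.ddown_of_diameter_zero] at hq
      exact Eq.symm (by simpa using hq)
    · have hl : Fin.last d ≠ 0 := fun e => by simp [Fin.ext_iff] at e; omega
      rcases hq with rfl | rfl | rfl | rfl
      · rfl
      · refine absurd (congrFun hs 0) ?_
        simpa [ScalarArray.down] using hpa.thetaStar_ne _ _ hl
      · refine absurd h0 ?_
        simpa [ScalarArray.ddown] using hpa.theta_ne _ _ hl
      · refine absurd h0 ?_
        simpa [ScalarArray.ddown, ScalarArray.down] using hpa.theta_ne _ _ hl
  · rintro ⟨B, Bs⟩ ⟨hB, σ, h1, h2⟩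
    obtain ⟨p, hp⟩ := hB.exists_designated
    obtain ⟨h3, h4⟩ := hp.eq hB.diagonal
    refine ⟨p, ?_, h4⟩
    have h5 := parameterArrays_map σ.symm isMatrixAlgebra_matrix h3
    simp only at h1 h2
    rwa [← h1, ← h2, σ.symm_apply_apply, σ.symm_apply_apply] at h5

theorem parameterArrays_nonempty (h : IsMatrixAlgebra K d 𝓐) {A As : 𝓐}
    (hA : IsLeonardPair K d A As) : (parameterArrays K d A As).Nonempty := by
  obtain ⟨E, hE⟩ := hA.exists_idempotentSequence
  obtain ⟨Es, hEs⟩ := hA.exists_dualIdempotentSequence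
  let Φ : LeonardSystem K d 𝓐 := ⟨A, As, E, Es, hA.1, hA.2, hE, hEs⟩
  obtain ⟨p, hp⟩ := ScalarArray.exists_isOfSystem h Φ
  exact ⟨p, Φ, rfl, rfl, hp⟩

theorem ncard_parameterArrays (h : IsMatrixAlgebra K d 𝓐) {A As : 𝓐}
    (hA : IsLeonardPair K d A As) (hd : 1 ≤ d) : (parameterArrays K d A As).ncard = 4 := by
  obtain ⟨p, hp⟩ := parameterArrays_nonempty h hA
  have hpa := isParameterArray_of_mem h hp
  have hl : Fin.last d ≠ 0 := fun e => by simp [Fin.ext_iff] at e; omega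
  have h1 := hpa.theta_ne _ _ hl
  have h2 := hpa.thetaStar_ne _ _ hl
  have ne_of_theta : ∀ {q r : ScalarArray K d}, q.theta 0 ≠ r.theta 0 → q ≠ r :=
    fun hne e => hne (by rw [e])
  have ne_of_thetaStar : ∀ {q r : ScalarArray K d}, q.thetaStar 0 ≠ r.thetaStar 0 → q ≠ r :=
    fun hne e => hne (by rw [e])
  have e1 : p ≠ p.down := ne_of_thetaStar (by simpa [ScalarArray.down] using h2.symm)
  have e2 : p ≠ p.ddown := ne_of_theta (by simpa [ScalarArray.ddown] using h1.symm)
  have e3 : p ≠ p.down.ddown :=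
    ne_of_theta (by simpa [ScalarArray.ddown, ScalarArray.down] using h1.symm)
  have e4 : p.down ≠ p.ddown :=
    ne_of_theta (by simpa [ScalarArray.ddown, ScalarArray.down] using h1.symm)
  have e5 : p.down ≠ p.down.ddown :=
    ne_of_theta (by simpa [ScalarArray.ddown, ScalarArray.down] using h1.symm)
  have e6 : p.ddown ≠ p.down.ddown :=
    ne_of_thetaStar (by simpa [ScalarArray.ddown, ScalarArray.down] using h2.symm)
  rw [parameterArrays_eq h hp, Set.ncard_insert_of_notMem (by simp [e1, e2, e3]),
    Set.ncard_insert_of_notMem (by simp [e4, e5]), Set.ncard_pair e6]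

end Canonical

end LeonardPairs

theorem mainTheorem9 {K : Type u} [Field K] (d : ℕ) {𝓐 : Type v} [Ring 𝓐] [Algebra K 𝓐]
    (h𝓐 : LeonardPairs.IsMatrixAlgebra K d 𝓐)
    (A As : 𝓐) (hA : LeonardPairs.IsLeonardPair K d A As) :
    -- the parameter arrays of `A, As`
    (∀ p ∈ LeonardPairs.parameterArrays K d A As,
      p.IsParameterArray ∧
      LeonardPairs.parameterArrays K d A As = {p, p.down, p.ddown, p.down.ddown}) ∧
    -- the bijection
    Set.BijOn (fun p : LeonardPairs.ScalarArray K d => (p.tMatrix, p.dMatrix))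
      (LeonardPairs.parameterArrays K d A As) (LeonardPairs.tddCanonicalForms K d A As) ∧
    -- its inverse
    (∀ C ∈ LeonardPairs.tddCanonicalForms K d A As, ∀ p : LeonardPairs.ScalarArray K d,
      LeonardPairs.IsDesignatedParameterArray C.1 C.2 p ↔
        p ∈ LeonardPairs.parameterArrays K d A As ∧ (p.tMatrix, p.dMatrix) = C) ∧
    -- the number of canonical forms
    (1 ≤ d → (LeonardPairs.tddCanonicalForms K d A As).ncard = 4) ∧
    (d = 0 → (LeonardPairs.tddCanonicalForms K d A As).ncard = 1) := by
  have hbij := LeonardPairs.bijOn_tMatrix h𝓐 hA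
  have hcard : (LeonardPairs.tddCanonicalForms K d A As).ncard =
      (LeonardPairs.parameterArrays K d A As).ncard := by
    rw [← hbij.image_eq, hbij.injOn.ncard_image]
  refine ⟨fun p hp => ⟨LeonardPairs.isParameterArray_of_mem h𝓐 hp,
    LeonardPairs.parameterArrays_eq h𝓐 hp⟩, hbij, ?_, fun hd => ?_, ?_⟩
  · rintro ⟨B, Bs⟩ ⟨hB, σ, h1, h2⟩ p
    simp only at h1 h2 hB ⊢
    constructor
    · intro hp
      obtain ⟨h3, h4⟩ := hp.eq hB.diagonal
      have h5 := LeonardPairs.parameterArrays_map σ.symm LeonardPairs.isMatrixAlgebra_matrix h3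
      rw [← h1, ← h2, σ.symm_apply_apply, σ.symm_apply_apply] at h5
      exact ⟨h5, h4⟩
    · rintro ⟨hp, h4⟩
      have h5 := LeonardPairs.parameterArrays_map σ h𝓐 hp
      rw [h1, h2] at h5
      obtain ⟨Φ, hΦ, hΦs, hpΦ⟩ := h5
      rw [Prod.mk.injEq] at h4
      refine ⟨Φ, hΦ, hΦs, hpΦ, ?_, fun i => ?_⟩
      · rw [← h4.1]
        exact (LeonardPairs.exists_algEquiv_tMatrix h𝓐 hp).2
      · rw [← h4.2, LeonardPairs.ScalarArray.dMatrix, Matrix.diagonal_apply_eq]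
  · rw [hcard]
    exact LeonardPairs.ncard_parameterArrays h𝓐 hA hd
  · rintro rfl
    obtain ⟨p, hp⟩ := LeonardPairs.parameterArrays_nonempty h𝓐 hA
    rw [hcard, LeonardPairs.parameterArrays_eq h𝓐 hp, p.down_of_diameter_zero,
      p.ddown_of_diameter_zero]
    simp
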